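/- Let $n,m\ge 1$ be integers and $\breve\delta=(\delta_0,\dots,\delta_{m-1})\in\mathbb C^m$. A \emph{planar diagram} in $m$ colours has a top and a bottom row of $n$ nodes, each node having one of the colours $0,\dots,m-1$; the nodes are joined in pairs by edges drawn inside a rectangle, each edge joins two nodes of the same colour, and edges of the same colour do not cross (edges of different colours may cross). The \emph{bubble algebra} $\mathbb T_{n,m}(\breve\delta)$ is the complex algebra with basis the planar diagrams. The product of two diagrams is $0$ unless the colours of the bottom row of the first agree with those of the top row of the second; otherwise it is the concatenation (first diagram above the second), where each closed loop of colour $j$ is replaced by the factor $\delta_j$. For $m=1$ this is the Temperley–Lieb algebra $\mathsf{TL}_n(\delta)$. For $k\ge 0$ let $\Gamma_{(k,m)}$ be the set of $m$-tuples of non-negative integers with sum $k$, and let $\lambda\in\Gamma_{(n-2v,m)}$ with $v\ge 0$. The cell module $\Delta_n(\lambda)$ has as basis the half-diagrams (top halves of planar diagrams cut through their propagating lines) with $n$ nodes and exactly $\lambda_j$ cut lines (defects) of colour $j$ for every $j$. A diagram acts by concatenation, with the same rules for colours and loops, and the result is $0$ if some propagating line is lost. For half-diagrams $x,y$ put $\langle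 x,y\rangle=0$ unless the colours of the nodes of $x$ and $y$ agree and, when the reflection of $x$ is glued to $y$, every defect of $x$ is connected to a defect of $y$; in that case $\langle x,y\rangle=\prod_j\delta_j^{c_j}$, where $c_j$ is the number of closed loops of colour $j$. Write $\lambda\in\Lambda^0$ if this bilinear form on $\Delta_n(\lambda)$ is not zero. For $m=1$ and $2p\le k$ let $\mathsf V_{k,p}=\Delta_k(k-2p)$ be the cell module of $\mathsf{TL}_k(\delta)$ spanned by the link states with $k$ nodes and $p$ arcs, and let $\mathsf L_{k,p,\delta}=\mathsf V_{k,p}/\mathsf R_{k,p,\delta}$, where $\mathsf R_{k,p,\delta}$ is the radical of the bilinear form on $\mathsf V_{k,p}$ (so $\mathsf L_{k,p,\delta}=0$ if this form is zero). For $\mu\in\Gamma_{(n,m)}$ put $n_\mu=\binom{n}{\mu_0,\dots,\mu_{m-1}}$. \textbf{Statement.} Let $\lambda\in\Lambda^0$ with $\lambda\in\Gamma_{(n-2v,m)}$, and let $\mathsf L_n(\lambda)$ be the head of the $\mathbb T_{n,m}(\breve\delta)$-module $\Delta_n(\lambda)$, that is, its quotient by the intersection of its maximal submodules. Then $\mathsf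 L_n(\lambda)$ is a simple module, $$\dim \mathsf L_n(\lambda)=\sum_{u\in\Gamma_{(v,m)}} n_{\lambda+2u}\prod_{i=0}^{m-1}\dim \mathsf L_{\lambda_i+2u_i,\,u_i,\,\delta_i},$$ and, as a complex vector space, $$\mathsf L_n(\lambda)\;\cong\;\bigoplus_{u\in\Gamma_{(v,m)}}\ \bigoplus^{\,n_{\lambda+2u}}\ \mathsf L_{\lambda_0+2u_0,\,u_0,\,\delta_0}\otimes\cdots\otimes \mathsf L_{\lambda_{m-1}+2u_{m-1},\,u_{m-1},\,\delta_{m-1}} .$$ -/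

import Mathlib

namespace Bubble

section Glue

theorem map_le_iff {A B : Type} (r : Setoid A) (f : A → B) (t : Setoid B) :
    r.map f ≤ t ↔ r ≤ t.comap f := by
  constructor
  · intro h a b hab
    exact h (Setoid.le_comap_map hab)
  · intro h
    refine Setoid.eqvGen_le ?_
    rintro x y ⟨a, b, hab, rfl, rfl⟩
    exact h hab

theorem map_map' {A B C : Type} (r : Setoid A) (f : A → B) (g : B → C) :
    (r.map f).map g = r.map (g ∘ f) := by
  apply le_antisymm
  · rw [map_le_iff, map_le_iff]
    intro a b hab
    exact Setoid.le_comap_map (f := g ∘ f) hab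
  · rw [map_le_iff]
    intro a b hab
    exact Setoid.le_comap_map (f := g) (Setoid.le_comap_map (f := f) hab)

theorem map_sup' {A B : Type} (r s : Setoid A) (f : A → B) :
    (r ⊔ s).map f = r.map f ⊔ s.map f := by
  apply le_antisymm
  · rw [map_le_iff]
    refine sup_le ?_ ?_
    · rw [← map_le_iff]; exact le_sup_left
    · rw [← map_le_iff]; exact le_sup_right
  · refine sup_le ?_ ?_
    · rw [map_le_iff]; exact le_trans le_sup_left Setoid.le_comap_map
    · rw [map_le_iff]; exact le_trans le_sup_right Setoid.le_comap_map

/-- The relation `S ⊔ U.map i` described through representatives in the image of `i`. -/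
theorem sup_map_iff {A B : Type} (S : Setoid A) (U : Setoid B) (i : B → A) (a b : A) :
    (S ⊔ U.map i) a b ↔
      S a b ∨ ∃ p q, S a (i p) ∧ (S.comap i ⊔ U) p q ∧ S (i q) b := by
  constructor
  · let T : Setoid A :=
      { r := fun a b => S a b ∨ ∃ p q, S a (i p) ∧ (S.comap i ⊔ U) p q ∧ S (i q) b
        iseqv :=
          { refl := fun a => Or.inl (S.refl' a)
            symm := by
              rintro a b (h | ⟨p, q, h1, h2, h3⟩)
              · exact Or.inl (S.symm' h)
              · exact Or.inr ⟨q, p, S.symm' h3, Setoid.symm' _ h2, S.symm' h1⟩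
            trans := by
              rintro a b c (h | ⟨p, q, h1, h2, h3⟩) (h' | ⟨p', q', h1', h2', h3'⟩)
              · exact Or.inl (S.trans' h h')
              · exact Or.inr ⟨p', q', S.trans' h h1', h2', h3'⟩
              · exact Or.inr ⟨p, q, h1, h2, S.trans' h3 h'⟩
              · refine Or.inr ⟨p, q', h1, ?_, h3'⟩
                have h4 : (S.comap i) q p' := S.trans' h3 h1'
                exact Setoid.trans' _ h2
                  (Setoid.trans' _ ((le_sup_left : S.comap i ≤ S.comap i ⊔ U) h4) h2') } }
    have h : S ⊔ U.map i ≤ T := by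
      refine sup_le (fun {a b} h => Or.inl h) ?_
      rw [map_le_iff]
      intro p q h
      exact Or.inr ⟨p, q, S.refl' _, (le_sup_right : U ≤ S.comap i ⊔ U) h, S.refl' _⟩
    intro hab
    exact h hab
  · have h0 : S.comap i ⊔ U ≤ (S ⊔ U.map i).comap i := by
      refine sup_le ?_ ?_
      · intro p q h
        exact (le_sup_left : S ≤ S ⊔ U.map i) h
      · rw [← map_le_iff]; exact le_sup_right
    have h1 : S ≤ S ⊔ U.map i := le_sup_left
    rintro (h | ⟨p, q, ha, hpq, hb⟩)
    · exact h1 h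
    · exact Setoid.trans' _ (h1 ha) (Setoid.trans' _ (h0 hpq) (h1 hb))

theorem comap_sup_map {A B : Type} (S : Setoid A) (U : Setoid B) (i : B → A) :
    (S ⊔ U.map i).comap i = S.comap i ⊔ U := by
  ext p q
  change (S ⊔ U.map i) (i p) (i q) ↔ _
  rw [sup_map_iff]
  constructor
  · rintro (h | ⟨p', q', h1, h2, h3⟩)
    · exact (le_sup_left : S.comap i ≤ _) h
    · exact Setoid.trans' _ ((le_sup_left : S.comap i ≤ S.comap i ⊔ U) h1)
        (Setoid.trans' _ h2 ((le_sup_left : S.comap i ≤ S.comap i ⊔ U) h3))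
  · intro h
    exact Or.inr ⟨p, q, S.refl' _, h, S.refl' _⟩

theorem map_iff {A B : Type} (G : Setoid B) (k : B → A) (hk : Function.Injective k) (a b : A) :
    G.map k a b ↔ a = b ∨ ∃ p q, G p q ∧ k p = a ∧ k q = b := by
  have h := sup_map_iff (⊥ : Setoid A) G k a b
  have h0 : (⊥ : Setoid A).comap k = ⊥ := by
    ext p q; exact ⟨fun h => hk h, fun h => congrArg k h⟩
  rw [h0, bot_sup_eq, bot_sup_eq] at h
  rw [h]
  constructor
  · rintro (h | ⟨p, q, h1, h2, h3⟩)
    · exact Or.inl h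
    · exact Or.inr ⟨p, q, h2, Eq.symm h1, h3⟩
  · rintro (h | ⟨p, q, h1, h2, h3⟩)
    · exact Or.inl h
    · exact Or.inr ⟨p, q, Eq.symm h2, h1, h3⟩

theorem comap_map_square {A B C D : Type} (G : Setoid C) (i : B → A) (k : C → A)
    (i' : D → B) (k' : D → C) (hi : Function.Injective i) (hk : Function.Injective k)
    (hcomm : ∀ d, i (i' d) = k (k' d)) (hpull : ∀ b c, i b = k c → ∃ d, i' d = b ∧ k' d = c) :
    (G.map k).comap i = (G.comap k').map i' := by
  ext b b'
  change G.map k (i b) (i b') ↔ _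
  rw [map_iff G k hk]
  constructor
  · rintro (h | ⟨p, q, h1, h2, h3⟩)
    · rw [hi h]
    · obtain ⟨d, rfl, rfl⟩ := hpull b p h2.symm
      obtain ⟨d', rfl, rfl⟩ := hpull b' q h3.symm
      exact Setoid.le_comap_map (f := i') (r := G.comap k') h1
  · intro h
    have : (G.comap k').map i' ≤ (G.map k).comap i := by
      rw [map_le_iff]
      intro d d' hd
      change G.map k (i (i' d)) (i (i' d'))
      rw [hcomm, hcomm]
      exact Setoid.le_comap_map (f := k) hd
    rw [← map_iff G k hk]
    exact this h

/-- The number of blocks of `F` that are contained in `K`. -/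
noncomputable def blocksIn {A : Type} (F : Setoid A) (K : Set A) : ℕ :=
  {C ∈ F.classes | C ⊆ K}.ncard

theorem blocksIn_sup_map {A B : Type} [Finite A] (S : Setoid A) (U : Setoid B) (i : B → A)
    (K : Set A) (hK : ∀ a p, a ∉ Set.range i → (S ⊔ U.map i) a (i p) → i p ∈ K → a ∈ K) :
    blocksIn (S ⊔ U.map i) K =
      blocksIn (S.comap i ⊔ U) (i ⁻¹' K) + blocksIn S (K \ Set.range i) := by
  set F := S ⊔ U.map i with hF
  have hE : F.comap i = S.comap i ⊔ U := comap_sup_map S U i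
  rw [← hE]
  have hsplit : {C ∈ F.classes | C ⊆ K} =
      {C ∈ F.classes | C ⊆ K ∧ ∃ p, i p ∈ C} ∪ {C ∈ S.classes | C ⊆ K \ Set.range i} := by
    ext C
    simp only [Set.mem_ofPred_eq, Set.mem_union]
    constructor
    · rintro ⟨⟨y, rfl⟩, hC⟩
      by_cases hp : ∃ p, i p ∈ {x | F x y}
      · exact Or.inl ⟨⟨y, rfl⟩, hC, hp⟩
      · right
        refine ⟨⟨y, ?_⟩, fun x hx => ⟨hC hx, ?_⟩⟩
        · ext x
          constructor
          · intro hx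
            rcases (sup_map_iff S U i x y).1 hx with h | ⟨p, q, h1, h2, h3⟩
            · exact h
            · exact absurd ⟨q, (le_sup_left : S ≤ F) h3⟩ hp
          · intro hx
            exact (le_sup_left : S ≤ F) hx
        · rintro ⟨p, rfl⟩
          exact hp ⟨p, hx⟩
    · rintro (⟨h1, h2, -⟩ | ⟨⟨y, rfl⟩, hC⟩)
      · exact ⟨h1, h2⟩
      · refine ⟨⟨y, ?_⟩, fun x hx => (hC hx).1⟩
        ext x
        constructor
        · intro hx
          exact (le_sup_left : S ≤ F) hx
        · intro hx
          rcases (sup_map_iff S U i x y).1 hx with h | ⟨p, q, h1, h2, h3⟩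
          · exact h
          · exact absurd ⟨q, rfl⟩ (hC (show i q ∈ {x | S x y} from h3)).2
  have hdisj : Disjoint {C ∈ F.classes | C ⊆ K ∧ ∃ p, i p ∈ C}
      {C ∈ S.classes | C ⊆ K \ Set.range i} := by
    rw [Set.disjoint_left]
    rintro C ⟨-, -, p, hp⟩ ⟨-, hC⟩
    exact (hC hp).2 ⟨p, rfl⟩
  have himg : {D ∈ (F.comap i).classes | D ⊆ i ⁻¹' K} =
      (fun C => i ⁻¹' C) '' {C ∈ F.classes | C ⊆ K ∧ ∃ p, i p ∈ C} := by
    ext D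
    simp only [Set.mem_ofPred_eq, Set.mem_image]
    constructor
    · rintro ⟨⟨q, rfl⟩, hD⟩
      refine ⟨{x | F x (i q)}, ⟨⟨i q, rfl⟩, ?_, q, F.refl' _⟩, rfl⟩
      intro a ha
      by_cases har : a ∈ Set.range i
      · obtain ⟨p, rfl⟩ := har
        exact hD (show p ∈ {x | F (i x) (i q)} from ha)
      · exact hK a q har ha (hD (show q ∈ {x | F (i x) (i q)} from F.refl' _))
    · rintro ⟨C, ⟨⟨y, rfl⟩, hC, p, hp⟩, rfl⟩
      refine ⟨⟨p, ?_⟩, fun x hx => hC hx⟩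
      ext x
      exact ⟨fun h => F.trans' h (F.symm' hp), fun h => F.trans' h hp⟩
  have hinj : Set.InjOn (fun C => i ⁻¹' C) {C ∈ F.classes | C ⊆ K ∧ ∃ p, i p ∈ C} := by
    rintro C ⟨⟨y, rfl⟩, -, p, hp⟩ C' ⟨⟨y', rfl⟩, -, p', hp'⟩ h
    have h1 : p ∈ i ⁻¹' {x | F x y'} := (Set.ext_iff.1 h p).1 hp
    have hyy : F y y' := F.trans' (F.symm' hp) h1
    ext x
    exact ⟨fun h => F.trans' h hyy, fun h => F.trans' h (F.symm' hyy)⟩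
  have hfin : ∀ s : Set (Set A), s.Finite := fun s => Set.toFinite s
  unfold blocksIn
  rw [hsplit, Set.ncard_union_eq hdisj (hfin _) (hfin _), himg, hinj.ncard_image]

theorem blocksIn_eq_zero {A : Type} (S : Setoid A) : blocksIn S ∅ = 0 := by
  have : {C ∈ S.classes | C ⊆ ∅} = ∅ := by
    ext C
    simp only [Set.mem_ofPred_eq, Set.mem_empty_iff_false, iff_false, not_and]
    rintro ⟨y, rfl⟩ h
    exact h (show y ∈ {x | S x y} from S.refl' y)
  rw [blocksIn, this, Set.ncard_empty]

theorem blocksIn_map {A B : Type} [Finite A] (G : Setoid B) (k : B → A)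
    (hk : Function.Injective k) (K : Set A) (hK : K ⊆ Set.range k) :
    blocksIn (G.map k) K = blocksIn G (k ⁻¹' K) := by
  have h0 : (⊥ : Setoid A).comap k = ⊥ := by
    ext p q; exact ⟨fun h => hk h, fun h => congrArg k h⟩
  have h := blocksIn_sup_map (⊥ : Setoid A) G k K (by
    intro a p ha hap _
    rw [bot_sup_eq, map_iff G k hk] at hap
    rcases hap with h | ⟨p, q, -, h, -⟩
    · exact absurd ⟨p, h.symm⟩ ha
    · exact absurd ⟨p, h⟩ ha)
  rw [h0, bot_sup_eq, bot_sup_eq, Set.sdiff_eq_empty.2 hK, blocksIn_eq_zero, add_zero] at h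
  exact h

variable {X Y Z W : Type}

/-- Top and middle row inside the three rows. -/
def upper : X ⊕ Y → X ⊕ (Y ⊕ Z) := Sum.map id Sum.inl

/-- Middle and bottom row inside the three rows. -/
def lower : Y ⊕ Z → X ⊕ (Y ⊕ Z) := Sum.inr

/-- Top and bottom row inside the three rows. -/
def outer : X ⊕ Z → X ⊕ (Y ⊕ Z) := Sum.map id Sum.inr

/-- `r` is placed above `s`, and the bottom row of `r` is identified with the top row of `s`:
the connected components of the resulting graph on three rows. -/
def glue (r : Setoid (X ⊕ Y)) (s : Setoid (Y ⊕ Z)) : Setoid (X ⊕ (Y ⊕ Z)) :=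
  r.map upper ⊔ s.map lower

/-- The composite partition: forget the middle row. -/
def compRel (r : Setoid (X ⊕ Y)) (s : Setoid (Y ⊕ Z)) : Setoid (X ⊕ Z) :=
  (glue r s).comap outer

/-- The number of connected components that lie entirely in the part `K` of the middle row. -/
noncomputable def loops (r : Setoid (X ⊕ Y)) (s : Setoid (Y ⊕ Z)) (K : Set Y) : ℕ :=
  blocksIn (glue r s) ((fun y => Sum.inr (Sum.inl y)) '' K)

theorem upper_injective : Function.Injective (upper : X ⊕ Y → X ⊕ (Y ⊕ Z)) :=
  Function.Injective.sumMap Function.injective_id Sum.inl_injective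

theorem outer_injective : Function.Injective (outer : X ⊕ Z → X ⊕ (Y ⊕ Z)) :=
  Function.Injective.sumMap Function.injective_id Sum.inr_injective

theorem glue_le_iff (r : Setoid (X ⊕ Y)) (s : Setoid (Y ⊕ Z)) (t : Setoid (X ⊕ (Y ⊕ Z))) :
    glue r s ≤ t ↔ r ≤ t.comap upper ∧ s ≤ t.comap lower := by
  rw [glue, sup_le_iff, map_le_iff, map_le_iff]

theorem glue_upper (r : Setoid (X ⊕ Y)) (s : Setoid (Y ⊕ Z)) {a b : X ⊕ Y} (h : r a b) :
    glue r s (upper a) (upper b) :=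
  ((glue_le_iff r s _).1 le_rfl).1 h

theorem glue_lower (r : Setoid (X ⊕ Y)) (s : Setoid (Y ⊕ Z)) {a b : Y ⊕ Z} (h : s a b) :
    glue r s (lower a) (lower b) :=
  ((glue_le_iff r s _).1 le_rfl).2 h

/-- The first three of four rows. -/
def rows123 : X ⊕ (Y ⊕ Z) → X ⊕ (Y ⊕ (Z ⊕ W)) := Sum.map id (Sum.map id Sum.inl)

/-- The rows 1, 3, 4 of four rows. -/
def rows134 : X ⊕ (Z ⊕ W) → X ⊕ (Y ⊕ (Z ⊕ W)) := Sum.map id Sum.inr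

/-- The rows 1, 2, 4 of four rows. -/
def rows124 : X ⊕ (Y ⊕ W) → X ⊕ (Y ⊕ (Z ⊕ W)) := Sum.map id (Sum.map id Sum.inr)

/-- The rows 2, 3, 4 of four rows. -/
def rows234 : Y ⊕ (Z ⊕ W) → X ⊕ (Y ⊕ (Z ⊕ W)) := Sum.inr

theorem rows123_injective : Function.Injective (rows123 : X ⊕ (Y ⊕ Z) → X ⊕ (Y ⊕ (Z ⊕ W))) :=
  Function.Injective.sumMap Function.injective_id
    (Function.Injective.sumMap Function.injective_id Sum.inl_injective)

theorem rows134_injective : Function.Injective (rows134 : X ⊕ (Z ⊕ W) → X ⊕ (Y ⊕ (Z ⊕ W))) :=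
  Function.Injective.sumMap Function.injective_id Sum.inr_injective

theorem rows124_injective : Function.Injective (rows124 : X ⊕ (Y ⊕ W) → X ⊕ (Y ⊕ (Z ⊕ W))) :=
  Function.Injective.sumMap Function.injective_id
    (Function.Injective.sumMap Function.injective_id Sum.inr_injective)

/-- Three diagrams glued on four rows. -/
def glue4 (r : Setoid (X ⊕ Y)) (s : Setoid (Y ⊕ Z)) (t : Setoid (Z ⊕ W)) :
    Setoid (X ⊕ (Y ⊕ (Z ⊕ W))) :=
  (glue r s).map rows123 ⊔ (t.map lower).map rows134

theorem glue4_eq (r : Setoid (X ⊕ Y)) (s : Setoid (Y ⊕ Z)) (t : Setoid (Z ⊕ W)) :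
    glue4 r s t = (glue s t).map rows234 ⊔ (r.map upper).map rows124 := by
  simp only [glue4, glue, map_sup', map_map']
  have h1 : (rows123 ∘ upper : X ⊕ Y → X ⊕ (Y ⊕ (Z ⊕ W))) = rows124 ∘ upper := by
    ext a; rcases a with a | a <;> rfl
  have h2 : (rows123 ∘ lower : Y ⊕ Z → X ⊕ (Y ⊕ (Z ⊕ W))) = rows234 ∘ upper := by
    ext a; rcases a with a | a <;> rfl
  have h3 : (rows134 ∘ lower : Z ⊕ W → X ⊕ (Y ⊕ (Z ⊕ W))) = rows234 ∘ lower := by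
    ext a; rcases a with a | a <;> rfl
  rw [h1, h2, h3, sup_assoc, sup_comm]

theorem comap_glue_123 (r : Setoid (X ⊕ Y)) (s : Setoid (Y ⊕ Z)) :
    ((glue r s).map rows123).comap (rows134 : X ⊕ (Z ⊕ W) → X ⊕ (Y ⊕ (Z ⊕ W))) =
      (compRel r s).map upper := by
  refine comap_map_square _ _ _ upper outer rows134_injective rows123_injective ?_ ?_
  · rintro (a | a) <;> rfl
  · rintro (b | b | b) (c | c | c) h <;> simp [rows134, rows123] at h
    · exact ⟨Sum.inl b, rfl, by rw [h]; rfl⟩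
    · exact ⟨Sum.inr b, rfl, by rw [h]; rfl⟩

theorem comap_glue_234 (s : Setoid (Y ⊕ Z)) (t : Setoid (Z ⊕ W)) :
    ((glue s t).map rows234).comap (rows124 : X ⊕ (Y ⊕ W) → X ⊕ (Y ⊕ (Z ⊕ W))) =
      (compRel s t).map lower := by
  refine comap_map_square _ _ _ lower outer rows124_injective Sum.inr_injective ?_ ?_
  · rintro (a | a) <;> rfl
  · rintro (b | b | b) (c | c | c) h <;> simp [rows124, rows234] at h
    · exact ⟨Sum.inl b, rfl, by rw [h]; rfl⟩
    · exact ⟨Sum.inr b, rfl, by rw [h]; rfl⟩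

theorem comap_glue4_134 (r : Setoid (X ⊕ Y)) (s : Setoid (Y ⊕ Z)) (t : Setoid (Z ⊕ W)) :
    (glue4 r s t).comap rows134 = glue (compRel r s) t := by
  rw [glue4, comap_sup_map, comap_glue_123, glue]

theorem comap_glue4_124 (r : Setoid (X ⊕ Y)) (s : Setoid (Y ⊕ Z)) (t : Setoid (Z ⊕ W)) :
    (glue4 r s t).comap rows124 = glue r (compRel s t) := by
  rw [glue4_eq, comap_sup_map, comap_glue_234, glue, sup_comm]

theorem compRel_assoc (r : Setoid (X ⊕ Y)) (s : Setoid (Y ⊕ Z)) (t : Setoid (Z ⊕ W)) :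
    compRel (compRel r s) t = compRel r (compRel s t) := by
  have h : (rows134 ∘ outer : X ⊕ W → X ⊕ (Y ⊕ (Z ⊕ W))) = rows124 ∘ outer := by
    ext a; rcases a with a | a <;> rfl
  have h1 : compRel (compRel r s) t = (glue4 r s t).comap (rows134 ∘ outer) := by
    rw [compRel, ← comap_glue4_134]; rfl
  have h2 : compRel r (compRel s t) = (glue4 r s t).comap (rows124 ∘ outer) := by
    rw [compRel, ← comap_glue4_124]; rfl
  rw [h1, h2, h]

theorem loops_assoc [Finite X] [Finite Y] [Finite Z] [Finite W] {C : Type}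
    (r : Setoid (X ⊕ Y)) (s : Setoid (Y ⊕ Z)) (t : Setoid (Z ⊕ W))
    (cX : X → C) (cY : Y → C) (cZ : Z → C) (cW : W → C)
    (hr : r ≤ Setoid.ker (Sum.elim cX cY)) (hs : s ≤ Setoid.ker (Sum.elim cY cZ))
    (ht : t ≤ Setoid.ker (Sum.elim cZ cW)) (j : C) :
    loops r s {y | cY y = j} + loops (compRel r s) t {z | cZ z = j} =
      loops s t {z | cZ z = j} + loops r (compRel s t) {y | cY y = j} := by
  let col : X ⊕ (Y ⊕ (Z ⊕ W)) → C := Sum.elim cX (Sum.elim cY (Sum.elim cZ cW))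
  have hcol : glue4 r s t ≤ Setoid.ker col := by
    refine sup_le ?_ ?_
    · rw [map_le_iff, glue_le_iff]
      refine ⟨fun {a b} h => ?_, fun {a b} h => ?_⟩
      · have := hr h
        rcases a with a | a <;> rcases b with b | b <;> exact this
      · have := hs h
        rcases a with a | a <;> rcases b with b | b <;> exact this
    · rw [map_le_iff, map_le_iff]
      intro a b h
      have := ht h
      rcases a with a | a <;> rcases b with b | b <;> exact this
  let K : Set (X ⊕ (Y ⊕ (Z ⊕ W))) :=
    {a | col a = j ∧ ∃ b : Y ⊕ Z, a = Sum.inr (Sum.elim Sum.inl (Sum.inr ∘ Sum.inl) b)}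
  have e1 : blocksIn (glue4 r s t) K =
      loops (compRel r s) t {z | cZ z = j} + loops r s {y | cY y = j} := by
    rw [glue4, blocksIn_sup_map, comap_glue_123]
    · congr 1
      · rw [loops, glue]
        congr 1
        ext a
        rcases a with a | a | a <;> simp [K, col, rows134]
      · rw [blocksIn_map _ _ rows123_injective, loops]
        · congr 1
          ext a
          rcases a with a | a | a <;> simp [K, col, rows134, rows123]
        · rintro a ⟨⟨-, b | b, rfl⟩, -⟩
          · exact ⟨Sum.inr (Sum.inl b), rfl⟩
          · exact ⟨Sum.inr (Sum.inr b), rfl⟩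
    · intro a p ha h hp
      have h1 : col a = col (rows134 p) := hcol h
      rcases a with a | a | a
      · exact absurd ⟨Sum.inl a, rfl⟩ ha
      · exact ⟨h1.trans hp.1, Sum.inl a, rfl⟩
      · exact absurd ⟨Sum.inr a, rfl⟩ ha
  have e2 : blocksIn (glue4 r s t) K =
      loops r (compRel s t) {y | cY y = j} + loops s t {z | cZ z = j} := by
    have hcol' := hcol
    rw [glue4_eq] at hcol' ⊢
    rw [blocksIn_sup_map, comap_glue_234]
    · congr 1
      · rw [loops, glue, sup_comm]
        congr 1
        ext a
        rcases a with a | a | a <;> simp [K, col, rows124]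
      · rw [blocksIn_map _ rows234 Sum.inr_injective, loops]
        · congr 1
          ext a
          rcases a with a | a | a <;> simp [K, col, rows124, rows234]
        · rintro a ⟨⟨-, b | b, rfl⟩, -⟩
          · exact ⟨Sum.inl b, rfl⟩
          · exact ⟨Sum.inr (Sum.inl b), rfl⟩
    · intro a p ha h hp
      have h1 : col a = col (rows124 p) := hcol' h
      rcases a with a | a | a | a
      · exact absurd ⟨Sum.inl a, rfl⟩ ha
      · exact absurd ⟨Sum.inr (Sum.inl a), rfl⟩ ha
      · exact ⟨h1.trans hp.1, Sum.inr a, rfl⟩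
      · exact absurd ⟨Sum.inr (Sum.inr a), rfl⟩ ha
  omega

end Glue
section Pairings

variable {X Y Z : Type}

/-- All blocks have size two. -/
def IsPairing {A : Type} (r : Setoid A) : Prop := ∀ a, ∃! b, b ≠ a ∧ r a b

theorem IsPairing.partner {A : Type} {r : Setoid A} (h : IsPairing r) :
    ∃ f : A → A, (∀ a, f a ≠ a) ∧ (∀ a, r a (f a)) ∧ (∀ a b, b ≠ a → r a b → b = f a) ∧
      Function.Involutive f := by
  choose f hf hu using h
  refine ⟨f, fun a => (hf a).1, fun a => (hf a).2, fun a b h1 h2 => hu a b ⟨h1, h2⟩, fun a => ?_⟩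
  exact (hu (f a) a ⟨fun h => (hf a).1 h.symm, r.symm' (hf a).2⟩).symm

theorem two_involutions {A : Type} [Finite A] (F G : Equiv.Perm A) (hF : F * F = 1)
    (hG : G * G = 1) (a : A) (ha : G a = a) (ha' : F a ≠ a) :
    ∃ O : Set A, a ∈ O ∧ (∀ b, F b ∈ O ↔ b ∈ O) ∧ (∀ b, G b ∈ O ↔ b ∈ O) ∧
      (∀ T : Setoid A, (∀ b, T b (F b)) → (∀ b, T b (G b)) → ∀ b ∈ O, T a b) ∧
      ∃ b ∈ O, b ≠ a ∧ (F b = b ∨ G b = b) ∧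
        ∀ c ∈ O, c ≠ a → (F c = c ∨ G c = c) → c = b := by
  have hFi : ∀ b, F (F b) = b := fun b => congrArg (fun p : Equiv.Perm A => p b) hF
  have hGi : ∀ b, G (G b) = b := fun b => congrArg (fun p : Equiv.Perm A => p b) hG
  have hGinv : G⁻¹ = G := inv_eq_of_mul_eq_one_left hG
  have hFinv : F⁻¹ = F := inv_eq_of_mul_eq_one_left hF
  let h : Equiv.Perm A := G * F
  have hGk : ∀ k : ℤ, G ((h ^ k) a) = (h ^ (-k)) a := by
    intro k
    have h1 : G * h ^ k * G⁻¹ = h ^ (-k) := by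
      rw [← conj_zpow, zpow_neg, ← inv_zpow]
      congr 1
      simp only [h, mul_inv_rev, hGinv, hFinv]
      rw [← mul_assoc, hG, one_mul]
    have h2 := congrArg (fun p : Equiv.Perm A => p a) h1
    simp only [hGinv, Equiv.Perm.mul_apply, ha] at h2
    exact h2
  have hFk : ∀ k : ℤ, F ((h ^ k) a) = (h ^ (-(k + 1))) a := by
    intro k
    rw [← hGk (k + 1), add_comm, zpow_add, zpow_one, Equiv.Perm.mul_apply]
    simp only [h, Equiv.Perm.mul_apply, hGi]
  have hper : ∀ k l : ℤ, (h ^ k) a = (h ^ l) a ↔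
      (Function.minimalPeriod (h • ·) a : ℤ) ∣ (k - l) := by
    intro k l
    rw [← MulAction.zpow_smul_eq_iff_minimalPeriod_dvd, sub_eq_add_neg, add_comm, zpow_add,
      zpow_neg, mul_smul, inv_smul_eq_iff]
    rfl
  set L : ℕ := Function.minimalPeriod (h • ·) a with hL
  have hLpos : 0 < L := by
    have : a ∈ Function.periodicPts (h • ·) := by
      have := Function.Injective.mem_periodicPts (f := fun x : A => h • x)
        (MulAction.injective h) a
      exact this
    exact Function.minimalPeriod_pos_of_mem_periodicPts this
  have hL2 : L ≠ 1 := by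
    intro h1
    have := (hper 1 0).2 (by rw [h1]; simp)
    simp only [zpow_one, zpow_zero, Equiv.Perm.one_apply, h, Equiv.Perm.mul_apply] at this
    apply ha'
    have h2 := congrArg G this
    rw [hGi, ha] at h2
    exact h2
  refine ⟨{b | ∃ k : ℤ, (h ^ k) a = b}, ⟨0, rfl⟩, ?_, ?_, ?_, ?_⟩
  · have key : ∀ b, (∃ k : ℤ, (h ^ k) a = b) → ∃ k : ℤ, (h ^ k) a = F b := by
      rintro b ⟨k, rfl⟩
      exact ⟨_, (hFk k).symm⟩
    intro b
    refine ⟨fun hb => ?_, key b⟩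
    have := key _ hb
    rw [hFi] at this
    exact this
  · have key : ∀ b, (∃ k : ℤ, (h ^ k) a = b) → ∃ k : ℤ, (h ^ k) a = G b := by
      rintro b ⟨k, rfl⟩
      exact ⟨_, (hGk k).symm⟩
    intro b
    refine ⟨fun hb => ?_, key b⟩
    have := key _ hb
    rw [hGi] at this
    exact this
  · rintro T hTF hTG b ⟨k, rfl⟩
    have hTh : ∀ b, T b (h b) := fun b => T.trans' (hTF b) (hTG (F b))
    induction k using Int.induction_on with
    | zero => exact T.refl' a
    | succ i ih =>
      rw [add_comm, zpow_add, zpow_one, Equiv.Perm.mul_apply]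
      exact T.trans' ih (hTh _)
    | pred i ih =>
      refine T.trans' ih (T.symm' ?_)
      have := hTh ((h ^ (-(i : ℤ) - 1)) a)
      rw [← Equiv.Perm.mul_apply, ← zpow_one_add] at this
      convert this using 3
      ring_nf
  · refine ⟨(h ^ ((L : ℤ) / 2)) a, ⟨_, rfl⟩, ?_, ?_, ?_⟩
    · intro h1
      have h2 := (hper ((L : ℤ) / 2) 0).1 (by rw [h1]; simp)
      have h3 := Int.le_of_dvd (by omega) h2
      omega
    · rcases Nat.even_or_odd' L with ⟨c, hc | hc⟩
      · right
        rw [hGk, hper]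
        exact ⟨-1, by omega⟩
      · left
        rw [hFk, hper]
        exact ⟨-1, by omega⟩
    · rintro c ⟨k, rfl⟩ hca hfix
      have hmod : (h ^ k) a = (h ^ (k % (L : ℤ))) a := by
        rw [hper]
        exact Int.dvd_self_sub_emod
      rw [hmod] at hfix hca ⊢
      set l := k % (L : ℤ) with hl
      have hl0 : 0 ≤ l := Int.emod_nonneg _ (by omega)
      have hl1 : l < L := Int.emod_lt_of_pos _ (by omega)
      have hl2 : l ≠ 0 := by
        intro h0
        rw [h0] at hca
        exact hca rfl
      have hlL : l = (L : ℤ) / 2 := by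
        rcases hfix with hf | hg
        · rw [hFk, hper] at hf
          obtain ⟨e, he⟩ := hf
          have h1 : e < 0 := by
            by_contra hcon
            have : 0 ≤ (L : ℤ) * e := mul_nonneg (by omega) (by omega)
            omega
          have h2 : -2 < e := by
            by_contra hcon
            have : (L : ℤ) * e ≤ (L : ℤ) * (-2) := mul_le_mul_of_nonneg_left (by omega) (by omega)
            omega
          have : e = -1 := by omega
          subst this
          omega
        · rw [hGk, hper] at hg
          obtain ⟨e, he⟩ := hg
          have h1 : e < 0 := by
            by_contra hcon
            have : 0 ≤ (L : ℤ) * e := mul_nonneg (by omega) (by omega)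
            omega
          have h2 : -2 < e := by
            by_contra hcon
            have : (L : ℤ) * e ≤ (L : ℤ) * (-2) := mul_le_mul_of_nonneg_left (by omega) (by omega)
            omega
          have : e = -1 := by omega
          subst this
          omega
      rw [hlL]

theorem compRel_isPairing [Finite X] [Finite Y] [Finite Z] {r : Setoid (X ⊕ Y)}
    {s : Setoid (Y ⊕ Z)} (hr : IsPairing r) (hs : IsPairing s) : IsPairing (compRel r s) := by
  obtain ⟨f, hf1, hf2, hf3, hf4⟩ := hr.partner
  obtain ⟨g, hg1, hg2, hg3, hg4⟩ := hs.partner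
  let F' : X ⊕ (Y ⊕ Z) → X ⊕ (Y ⊕ Z) := fun a =>
    match a with
    | Sum.inl x => upper (f (Sum.inl x))
    | Sum.inr (Sum.inl y) => upper (f (Sum.inr y))
    | Sum.inr (Sum.inr z) => Sum.inr (Sum.inr z)
  let G' : X ⊕ (Y ⊕ Z) → X ⊕ (Y ⊕ Z) := fun a =>
    match a with
    | Sum.inl x => Sum.inl x
    | Sum.inr b => lower (g b)
  have hFu : ∀ a, F' (upper a) = upper (f a) := by rintro (a | a) <;> rfl
  have hGl : ∀ a, G' (lower a) = lower (g a) := fun a => rfl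
  have hFinv : Function.Involutive F' := by
    rintro (x | y | z)
    · change F' (upper (f (Sum.inl x))) = _
      rw [hFu, hf4]; rfl
    · change F' (upper (f (Sum.inr y))) = _
      rw [hFu, hf4]; rfl
    · rfl
  have hGinv : Function.Involutive G' := by
    rintro (x | b)
    · rfl
    · change G' (lower (g b)) = _
      rw [hGl, hg4]; rfl
  let F : Equiv.Perm (X ⊕ (Y ⊕ Z)) := hFinv.toPerm
  let G : Equiv.Perm (X ⊕ (Y ⊕ Z)) := hGinv.toPerm
  have hFF : F * F = 1 := Equiv.ext hFinv
  have hGG : G * G = 1 := Equiv.ext hGinv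
  have gF : ∀ b, glue r s b (F b) := by
    rintro (x | y | z)
    · exact glue_upper r s (hf2 (Sum.inl x))
    · exact glue_upper r s (hf2 (Sum.inr y))
    · exact Setoid.refl' _ _
  have gG : ∀ b, glue r s b (G b) := by
    rintro (x | b)
    · exact Setoid.refl' _ _
    · exact glue_lower r s (hg2 b)
  have gmin : ∀ O : Set (X ⊕ (Y ⊕ Z)), (∀ b, F b ∈ O ↔ b ∈ O) → (∀ b, G b ∈ O ↔ b ∈ O) →
      ∀ a b, glue r s a b → a ∈ O → b ∈ O := by
    intro O hO1 hO2 a b hab haO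
    have : glue r s ≤ Setoid.ker (fun a => a ∈ O) := by
      rw [glue_le_iff]
      refine ⟨fun {a b} h => ?_, fun {a b} h => ?_⟩
      · by_cases hb : b = a
        · subst hb; rfl
        · rw [hf3 a b hb h]
          change (upper a ∈ O) = (upper (f a) ∈ O)
          rw [← hFu]
          exact propext (hO1 _).symm
      · by_cases hb : b = a
        · subst hb; rfl
        · rw [hg3 a b hb h]
          exact propext (hO2 (lower a)).symm
    exact (this hab).mp haO
  have hend : ∀ c, (F c = c ∨ G c = c) → ∃ c', outer c' = c := by
    rintro (x | y | z) h
    · exact ⟨Sum.inl x, rfl⟩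
    · exfalso
      rcases h with h | h
      · exact hf1 (Sum.inr y) (upper_injective (Z := Z) h)
      · exact hg1 (Sum.inl y) (Sum.inr_injective h)
    · exact ⟨Sum.inr z, rfl⟩
  have hend' : ∀ c' : X ⊕ Z, F (outer c') = outer c' ∨ G (outer c') = outer c' := by
    rintro (x | z)
    · exact Or.inr rfl
    · exact Or.inl rfl
  have main : ∀ a' : X ⊕ Z, ∃ O : Set (X ⊕ (Y ⊕ Z)), outer a' ∈ O ∧
      (∀ b, F b ∈ O ↔ b ∈ O) ∧ (∀ b, G b ∈ O ↔ b ∈ O) ∧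
      (∀ T : Setoid (X ⊕ (Y ⊕ Z)), (∀ b, T b (F b)) → (∀ b, T b (G b)) →
        ∀ b ∈ O, T (outer a') b) ∧
      ∃ b ∈ O, b ≠ outer a' ∧ (F b = b ∨ G b = b) ∧
        ∀ c ∈ O, c ≠ outer a' → (F c = c ∨ G c = c) → c = b := by
    rintro (x | z)
    · exact two_involutions F G hFF hGG _ rfl
        (fun h => hf1 (Sum.inl x) (upper_injective (Z := Z) h))
    · obtain ⟨O, h1, h2, h3, h4, b, h5, h6, h7, h8⟩ :=
        two_involutions G F hGG hFF (outer (Sum.inr z)) rfl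
          (fun h => hg1 (Sum.inr z) (Sum.inr_injective h))
      exact ⟨O, h1, h3, h2, fun T a b => h4 T b a, b, h5, h6, h7.symm,
        fun c hc hc' hc'' => h8 c hc hc' hc''.symm⟩
  intro a'
  obtain ⟨O, h1, h2, h3, h4, b, h5, h6, h7, h8⟩ := main a'
  obtain ⟨b', rfl⟩ := hend b h7
  refine ⟨b', ⟨fun h => h6 (by rw [h]), h4 (glue r s) gF gG _ h5⟩, ?_⟩
  rintro c' ⟨hc1, hc2⟩
  refine outer_injective (h8 (outer c') (gmin O h2 h3 _ _ hc2 h1)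
    (fun h => hc1 (outer_injective h)) (hend' c'))

end Pairings

section Parity

open Classical in
/-- The number modulo two of points satisfying a predicate. -/
noncomputable def parity {A : Type} [Fintype A] (p : A → Prop) : ZMod 2 := ∑ a, if p a then 1 else 0

theorem parity_sum {A B : Type} [Fintype A] [Fintype B] (p : A ⊕ B → Prop) :
    parity p = parity (fun a => p (Sum.inl a)) + parity (fun b => p (Sum.inr b)) := by
  simp only [parity, Fintype.sum_sum_type]

theorem parity_false {A : Type} [Fintype A] : parity (fun _ : A => False) = 0 := by
  simp [parity]

theorem parity_single {A : Type} [Fintype A] (c : A) : parity (fun a : A => a = c) = 1 := by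
  rw [parity, Finset.sum_eq_single c (fun b _ hb => if_neg hb) (by simp), if_pos rfl]

theorem parity_eq_add {A : Type} [Fintype A] (p q r : A → Prop)
    (h : ∀ a, (p a ↔ q a ∨ r a) ∧ ¬ (q a ∧ r a)) : parity p = parity q + parity r := by
  rw [parity, parity, parity, ← Finset.sum_add_distrib]
  refine Finset.sum_congr rfl fun a _ => ?_
  obtain ⟨h1, h2⟩ := h a
  by_cases hq : q a <;> by_cases hr : r a <;> simp_all

theorem parity_between {A : Type} [Fintype A] {r : Setoid A} (hr : IsPairing r)
    {O : Type} [LinearOrder O] (β : A → O) (P : A → Prop) (hP : ∀ a b, r a b → P a → P b)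
    (u w : A) (hu : ¬ P u) (hw : ¬ P w) (hβ : Function.Injective β)
    (hplan : ∀ p q, P p → P q → r p q → β u < β p → β p < β w →
      ¬ (β q < β u) ∧ ¬ (β w < β q)) :
    parity (fun p => P p ∧ β u < β p ∧ β p < β w) = 0 := by
  classical
  obtain ⟨f, hf1, hf2, hf3, hf4⟩ := hr.partner
  have hsum : ∀ p : A → Prop, parity p = ∑ a ∈ Finset.univ.filter p, (1 : ZMod 2) := by
    intro p
    rw [Finset.sum_filter, parity]
  rw [hsum]
  refine Finset.sum_involution (fun a _ => f a) (fun a _ => by decide) (fun a _ _ => hf1 a) ?_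
    (fun a _ => hf4 a)
  intro a ha
  simp only [Finset.mem_filter, Finset.mem_univ, true_and] at ha ⊢
  obtain ⟨h1, h2, h3⟩ := ha
  have hfa := hP a (f a) (hf2 a) h1
  obtain ⟨h4, h5⟩ := hplan a (f a) h1 hfa (hf2 a) h2 h3
  refine ⟨hfa, lt_of_le_of_ne (not_lt.1 h4) ?_, lt_of_le_of_ne (not_lt.1 h5) ?_⟩
  · intro h; exact hu (hβ h ▸ hfa)
  · intro h; exact hw (hβ h ▸ hfa)

end Parity

section Boundary

variable {X Y : Type}

/-- The nodes on the boundary of the rectangle, in clockwise order: the top row from left to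
right, then the bottom row from right to left. -/
def boundary (a : X ⊕ Y) : X ⊕ₗ Yᵒᵈ := toLex (Sum.map id OrderDual.toDual a)

theorem boundary_injective : Function.Injective (boundary : X ⊕ Y → X ⊕ₗ Yᵒᵈ) :=
  toLex.injective.comp (Function.Injective.sumMap Function.injective_id OrderDual.toDual.injective)


end Boundary

section Planar

variable {X Y Z : Type} [LinearOrder X] [LinearOrder Y] [LinearOrder Z]

/-- No two edges of the same colour cross. -/
def IsPlanar {C : Type} (r : Setoid (X ⊕ Y)) (col : X ⊕ Y → C) : Prop :=
  ∀ a b c d : X ⊕ Y, boundary a < boundary b → boundary b < boundary c →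
    boundary c < boundary d → r a c → r b d → col a ≠ col b

@[simp] theorem boundary_inl_inl (x x' : X) :
    boundary (Sum.inl x : X ⊕ Y) < boundary (Sum.inl x') ↔ x < x' := Sum.Lex.inl_lt_inl_iff

@[simp] theorem boundary_inr_inr (y y' : Y) :
    boundary (Sum.inr y : X ⊕ Y) < boundary (Sum.inr y') ↔ y' < y := Sum.Lex.inr_lt_inr_iff

@[simp] theorem boundary_inl_inr (x : X) (y : Y) :
    boundary (Sum.inl x : X ⊕ Y) < boundary (Sum.inr y) := Sum.Lex.inl_lt_inr _ _

@[simp] theorem not_boundary_inr_inl (x : X) (y : Y) :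
    ¬ boundary (Sum.inr y : X ⊕ Y) < boundary (Sum.inl x) := Sum.Lex.not_inr_lt_inl

theorem parity_upper [Fintype X] [Fintype Y] {C : Type} {r : Setoid (X ⊕ Y)} (hr : IsPairing r)
    (col : X ⊕ Y → C) (hplan : IsPlanar r col) (P : X ⊕ Y → Prop)
    (hP : ∀ a b, r a b → P a → P b) (j : C) (hj : ∀ a, P a → col a = j) (u w : X ⊕ Y)
    (huw : r u w) (hu : ¬ P u) (hcu : col u = j) (hcw : col w = j) :
    parity (fun p => P p ∧ boundary u < boundary p) =
        parity (fun p => P p ∧ boundary w < boundary p) ∧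
      parity (fun p => P p ∧ boundary p < boundary u) =
        parity (fun p => P p ∧ boundary p < boundary w) := by
  have hw : ¬ P w := fun h => hu (hP w u (r.symm' huw) h)
  have key : ∀ u w : X ⊕ Y, r u w → ¬ P u → ¬ P w → col u = j → col w = j →
      boundary u < boundary w →
      parity (fun p => P p ∧ boundary u < boundary p) =
        parity (fun p => P p ∧ boundary w < boundary p) ∧
      parity (fun p => P p ∧ boundary p < boundary u) =
        parity (fun p => P p ∧ boundary p < boundary w) := by
    intro u w huw hu hw hcu hcw hlt
    have h0 : parity (fun p => P p ∧ boundary u < boundary p ∧ boundary p < boundary w) = 0 := by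
      refine parity_between hr boundary P hP u w hu hw boundary_injective ?_
      intro p q hp hq hpq h1 h2
      constructor
      · intro h3
        exact hplan q u p w h3 h1 h2 (r.symm' hpq) huw ((hj q hq).trans hcu.symm)
      · intro h3
        exact hplan u p w q h1 h2 h3 huw hpq (hcu.trans (hj p hp).symm)
    have hne : ∀ p, P p → boundary p ≠ boundary u ∧ boundary p ≠ boundary w := by
      intro p hp
      exact ⟨fun h => hu (boundary_injective h ▸ hp), fun h => hw (boundary_injective h ▸ hp)⟩
    constructor
    · rw [parity_eq_add _ (fun p => P p ∧ boundary u < boundary p ∧ boundary p < boundary w)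
        (fun p => P p ∧ boundary w < boundary p), h0, zero_add]
      intro p
      refine ⟨⟨?_, ?_⟩, ?_⟩
      · rintro ⟨h1, h2⟩
        rcases lt_or_gt_of_ne (hne p h1).2 with h | h
        · exact Or.inl ⟨h1, h2, h⟩
        · exact Or.inr ⟨h1, h⟩
      · rintro (⟨h1, h2, -⟩ | ⟨h1, h2⟩)
        · exact ⟨h1, h2⟩
        · exact ⟨h1, hlt.trans h2⟩
      · rintro ⟨⟨-, -, h1⟩, -, h2⟩
        exact lt_asymm h1 h2
    · rw [parity_eq_add (fun p => P p ∧ boundary p < boundary w)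
        (fun p => P p ∧ boundary p < boundary u)
        (fun p => P p ∧ boundary u < boundary p ∧ boundary p < boundary w), h0, add_zero]
      intro p
      refine ⟨⟨?_, ?_⟩, ?_⟩
      · rintro ⟨h1, h2⟩
        rcases lt_or_gt_of_ne (hne p h1).1 with h | h
        · exact Or.inl ⟨h1, h⟩
        · exact Or.inr ⟨h1, h, h2⟩
      · rintro (⟨h1, h2⟩ | ⟨h1, -, h2⟩)
        · exact ⟨h1, h2.trans hlt⟩
        · exact ⟨h1, h2⟩
      · rintro ⟨⟨-, h1⟩, -, h2, -⟩
        exact lt_asymm h1 h2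
  rcases lt_trichotomy (boundary u) (boundary w) with h | h | h
  · exact key u w huw hu hw hcu hcw h
  · rw [boundary_injective h]; exact ⟨rfl, rfl⟩
  · have := key w u (r.symm' huw) hw hu hcw hcu h
    exact ⟨this.1.symm, this.2.symm⟩

theorem compRel_isPlanar [Finite X] [Finite Y] [Finite Z] {C : Type} {r : Setoid (X ⊕ Y)}
    {s : Setoid (Y ⊕ Z)} (hr : IsPairing r) (hs : IsPairing s)
    (cX : X → C) (cY : Y → C) (cZ : Z → C)
    (hcr : r ≤ Setoid.ker (Sum.elim cX cY)) (hcs : s ≤ Setoid.ker (Sum.elim cY cZ))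
    (hpr : IsPlanar r (Sum.elim cX cY)) (hps : IsPlanar s (Sum.elim cY cZ)) :
    IsPlanar (compRel r s) (Sum.elim cX cZ) := by
  classical
  cases nonempty_fintype X
  cases nonempty_fintype Y
  cases nonempty_fintype Z
  intro a b c d hab hbc hcd hac hbd hcol
  have hpair := compRel_isPairing hr hs
  let P : X ⊕ (Y ⊕ Z) → Prop := fun p => glue r s (outer a) p
  let col : X ⊕ (Y ⊕ Z) → C := Sum.elim cX (Sum.elim cY cZ)
  have hcolo : ∀ q : X ⊕ Z, col (outer q) = Sum.elim cX cZ q := by rintro (q | q) <;> rfl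
  have hcolu : ∀ q : X ⊕ Y, col (upper q) = Sum.elim cX cY q := by rintro (q | q) <;> rfl
  have hcoll : ∀ q : Y ⊕ Z, col (lower q) = Sum.elim cY cZ q := by rintro (q | q) <;> rfl
  have hcg : glue r s ≤ Setoid.ker col := by
    rw [glue_le_iff]
    refine ⟨fun {p q} h => ?_, fun {p q} h => ?_⟩
    · change col (upper p) = col (upper q)
      rw [hcolu, hcolu]; exact hcr h
    · change col (lower p) = col (lower q)
      rw [hcoll, hcoll]; exact hcs h
  set j : C := Sum.elim cX cZ a with hj
  have hPj : ∀ p, P p → col p = j := by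
    intro p hp
    have : col (outer a) = col p := hcg hp
    rw [← this, hcolo]
  have hPg : ∀ p q, glue r s p q → P p → P q := fun p q h hp => Setoid.trans' _ hp h
  have hPouter : ∀ q : X ⊕ Z, P (outer q) ↔ q = a ∨ q = c := by
    intro q
    constructor
    · intro h
      by_cases hq : q = a
      · exact Or.inl hq
      · right
        have hca : c ≠ a := fun h => by rw [h] at hbc; exact lt_asymm hab hbc
        exact (hpair a).unique ⟨hq, h⟩ ⟨hca, hac⟩
    · rintro (rfl | rfl)
      · exact Setoid.refl' _ _
      · exact hac
  let N : X ⊕ (Y ⊕ Z) → ZMod 2 := fun p =>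
    match p with
    | Sum.inl x => parity (fun x' => P (Sum.inl x') ∧ x < x') +
        parity (fun y => P (Sum.inr (Sum.inl y)))
    | Sum.inr (Sum.inl y) => parity (fun y' => P (Sum.inr (Sum.inl y')) ∧ y' < y)
    | Sum.inr (Sum.inr z) => parity (fun y => P (Sum.inr (Sum.inl y))) +
        parity (fun z' => P (Sum.inr (Sum.inr z')) ∧ z < z')
  have hNu : ∀ u : X ⊕ Y,
      N (upper u) = parity (fun p : X ⊕ Y => P (upper p) ∧ boundary u < boundary p) := by
    rintro (x | y)
    · rw [parity_sum]; simp [N, upper]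
    · rw [parity_sum]; simp [N, upper, parity_false]
  have hNl : ∀ u : Y ⊕ Z,
      N (lower u) = parity (fun p : Y ⊕ Z => P (lower p) ∧ boundary p < boundary u) := by
    rintro (y | z)
    · rw [parity_sum]; simp [N, lower, parity_false]
    · rw [parity_sum]; simp [N, lower]
  have hinv : ∀ p q, glue r s p q → ¬ P p → col p = j → N p = N q := by
    let T : Setoid (X ⊕ (Y ⊕ Z)) :=
      { r := fun p q => (P p ↔ P q) ∧ col p = col q ∧ (¬ P p → col p = j → N p = N q)
        iseqv :=
          { refl := fun p => ⟨Iff.rfl, rfl, fun _ _ => rfl⟩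
            symm := fun {p q} h => ⟨h.1.symm, h.2.1.symm, fun h1 h2 =>
              (h.2.2 (fun h3 => h1 (h.1.1 h3)) (h.2.1.trans h2)).symm⟩
            trans := fun {p q t} h h' => ⟨h.1.trans h'.1, h.2.1.trans h'.2.1, fun h1 h2 =>
              (h.2.2 h1 h2).trans (h'.2.2 (fun h3 => h1 (h.1.2 h3)) (h.2.1.symm.trans h2))⟩ } }
    have hT : glue r s ≤ T := by
      rw [glue_le_iff]
      refine ⟨fun {p q} h => ?_, fun {p q} h => ?_⟩
      · have hg := glue_upper r s h
        have hc : col (upper p) = col (upper q) := hcg hg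
        refine ⟨⟨hPg _ _ hg, hPg _ _ (Setoid.symm' _ hg)⟩, hc, fun h1 h2 => ?_⟩
        rw [hNu, hNu]
        refine (parity_upper hr (Sum.elim cX cY) hpr (fun p => P (upper p)) ?_ j ?_ p q h h1 ?_
          ?_).1
        · exact fun a b hab => hPg _ _ (glue_upper r s hab)
        · intro a ha; rw [← hcolu]; exact hPj _ ha
        · rw [← hcolu]; exact h2
        · rw [← hcolu, ← hc]; exact h2
      · have hg := glue_lower r s h
        have hc : col (lower p) = col (lower q) := hcg hg
        refine ⟨⟨hPg _ _ hg, hPg _ _ (Setoid.symm' _ hg)⟩, hc, fun h1 h2 => ?_⟩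
        rw [hNl, hNl]
        refine (parity_upper hs (Sum.elim cY cZ) hps (fun p => P (lower p)) ?_ j ?_ p q h h1 ?_
          ?_).2
        · exact fun a b hab => hPg _ _ (glue_lower r s hab)
        · intro a ha; rw [← hcoll]; exact hPj _ ha
        · rw [← hcoll]; exact h2
        · rw [← hcoll, ← hc]; exact h2
    intro p q h
    exact (hT h).2.2
  have htwo : ∀ e : ZMod 2, e + e = 0 := by decide
  have hNo : ∀ q : X ⊕ Z, ¬ P (outer q) → N (outer q) =
      parity (fun y => P (Sum.inr (Sum.inl y))) + parity (fun z => P (Sum.inr (Sum.inr z))) +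
        parity (fun p : X ⊕ Z => P (outer p) ∧ boundary q < boundary p) := by
    rintro (x | z) hq
    · rw [parity_sum]
      simp only [N, outer, Sum.map_inl, Sum.map_inr, id, boundary_inl_inl, boundary_inl_inr,
        and_true]
      linear_combination -htwo (parity fun b => P (Sum.inr (Sum.inr b)))
    · rw [parity_sum]
      simp only [N, outer, Sum.map_inl, Sum.map_inr, id, boundary_inr_inr, not_boundary_inr_inl,
        and_false, parity_false]
      have := parity_eq_add (fun z' => P (Sum.inr (Sum.inr z')))
        (fun z' => P (Sum.inr (Sum.inr z')) ∧ z < z')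
        (fun z' => P (Sum.inr (Sum.inr z')) ∧ z' < z) (by
          intro z'
          refine ⟨⟨fun h => ?_, ?_⟩, fun h => lt_asymm h.1.2 h.2.2⟩
          · rcases lt_trichotomy z z' with h1 | h1 | h1
            · exact Or.inl ⟨h, h1⟩
            · exact absurd (h1 ▸ h) hq
            · exact Or.inr ⟨h, h1⟩
          · rintro (h | h) <;> exact h.1)
      rw [this]
      linear_combination -htwo (parity fun z' => P (Sum.inr (Sum.inr z')) ∧ z' < z)
  have hPb : ¬ P (outer b) := by
    rw [hPouter]
    rintro (h | h)
    · rw [h] at hab; exact lt_irrefl _ hab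
    · rw [h] at hbc; exact lt_irrefl _ hbc
  have hPd : ¬ P (outer d) := fun h => hPb (hPg _ _ (Setoid.symm' _ hbd) h)
  have h1 : N (outer b) = N (outer d) := hinv _ _ hbd hPb (by rw [hcolo]; exact hcol.symm)
  rw [hNo b hPb, hNo d hPd] at h1
  have h2 : parity (fun p : X ⊕ Z => P (outer p) ∧ boundary b < boundary p) = 1 := by
    have : (fun p : X ⊕ Z => P (outer p) ∧ boundary b < boundary p) = fun p => p = c := by
      ext p
      rw [hPouter]
      constructor
      · rintro ⟨rfl | rfl, h⟩
        · exact absurd h (lt_asymm hab)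
        · rfl
      · rintro rfl
        exact ⟨Or.inr rfl, hbc⟩
    rw [this, parity_single]
  have h3 : parity (fun p : X ⊕ Z => P (outer p) ∧ boundary d < boundary p) = 0 := by
    have : (fun p : X ⊕ Z => P (outer p) ∧ boundary d < boundary p) = fun _ => False := by
      ext p
      rw [hPouter, iff_false]
      rintro ⟨rfl | rfl, h⟩
      · exact lt_asymm (hab.trans (hbc.trans hcd)) h
      · exact lt_asymm hcd h
    rw [this, parity_false]
  rw [h2, h3, add_left_cancel_iff] at h1
  exact one_ne_zero h1
end Planar
section Units

variable {X Y : Type}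

theorem compRel_one_left (s : Setoid (X ⊕ Y)) :
    compRel (Setoid.ker (Sum.elim id id)) s = s := by
  let π : X ⊕ (X ⊕ Y) → X ⊕ Y := Sum.elim Sum.inl id
  have h : glue (Setoid.ker (Sum.elim id id)) s ≤ s.comap π := by
    rw [glue_le_iff]
    refine ⟨fun {a b} hab => ?_, fun {a b} hab => hab⟩
    have hab' : (Sum.elim id id a : X) = Sum.elim id id b := hab
    have : π (upper a) = π (upper b) := by
      rcases a with a | a <;> rcases b with b | b <;> exact congrArg Sum.inl hab'
    change s (π (upper a)) (π (upper b))
    rw [this]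
  have h2 : ∀ a : X ⊕ Y,
      glue (Setoid.ker (Sum.elim id id)) s (outer a) (lower a) := by
    rintro (x | y)
    · exact glue_upper (Setoid.ker (Sum.elim id id)) s (a := Sum.inl x) (b := Sum.inr x) rfl
    · exact Setoid.refl' _ _
  ext a b
  constructor
  · intro hab
    have := h hab
    rcases a with a | a <;> rcases b with b | b <;> exact this
  · intro hab
    exact (glue _ s).trans' (h2 a) ((glue _ s).trans' (glue_lower _ _ hab) ((glue _ s).symm' (h2 b)))

theorem compRel_one_right (s : Setoid (X ⊕ Y)) :
    compRel s (Setoid.ker (Sum.elim id id)) = s := by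
  let π : X ⊕ (Y ⊕ Y) → X ⊕ Y := Sum.elim Sum.inl (Sum.elim Sum.inr Sum.inr)
  have h : glue s (Setoid.ker (Sum.elim id id)) ≤ s.comap π := by
    rw [glue_le_iff]
    refine ⟨fun {a b} hab => ?_, fun {a b} hab => ?_⟩
    · rcases a with a | a <;> rcases b with b | b <;> exact hab
    · have hab' : (Sum.elim id id a : Y) = Sum.elim id id b := hab
      have : π (lower a) = π (lower b) := by
        rcases a with a | a <;> rcases b with b | b <;> exact congrArg Sum.inr hab'
      change s (π (lower a)) (π (lower b))
      rw [this]
  have h2 : ∀ a : X ⊕ Y,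
      glue s (Setoid.ker (Sum.elim id id)) (outer a) (upper a) := by
    rintro (x | y)
    · exact Setoid.refl' _ _
    · exact glue_lower s (Setoid.ker (Sum.elim id id)) (a := Sum.inr y) (b := Sum.inl y) rfl
  ext a b
  constructor
  · intro hab
    have := h hab
    rcases a with a | a <;> rcases b with b | b <;> exact this
  · intro hab
    exact (glue s _).trans' (h2 a) ((glue s _).trans' (glue_upper _ _ hab) ((glue s _).symm' (h2 b)))

variable [Finite X] [Finite Y]

theorem loops_one_left (s : Setoid (X ⊕ Y)) (K : Set X) :
    loops (Setoid.ker (Sum.elim id id)) s K = 0 := by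
  rw [loops, blocksIn, Set.ncard_eq_zero, Set.eq_empty_iff_forall_notMem]
  rintro C ⟨⟨a, rfl⟩, hC⟩
  obtain ⟨x, -, hx⟩ := hC (show a ∈ {b | glue (Setoid.ker (Sum.elim id id)) s b a} from
    (glue _ s).refl' a)
  have h1 : glue (Setoid.ker (Sum.elim id id)) s (Sum.inl x) a := by
    rw [← hx]
    exact glue_upper (Setoid.ker (Sum.elim id id)) s (a := Sum.inl x) (b := Sum.inr x) rfl
  obtain ⟨y, -, hy⟩ := hC h1
  exact absurd hy (by simp)

theorem loops_one_right (s : Setoid (X ⊕ Y)) (K : Set Y) :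
    loops s (Setoid.ker (Sum.elim id id)) K = 0 := by
  rw [loops, blocksIn, Set.ncard_eq_zero, Set.eq_empty_iff_forall_notMem]
  rintro C ⟨⟨a, rfl⟩, hC⟩
  obtain ⟨x, -, hx⟩ := hC (show a ∈ {b | glue s (Setoid.ker (Sum.elim id id)) b a} from
    (glue s _).refl' a)
  have h1 : glue s (Setoid.ker (Sum.elim id id)) (Sum.inr (Sum.inr x)) a := by
    rw [← hx]
    exact glue_lower s (Setoid.ker (Sum.elim id id)) (a := Sum.inr x) (b := Sum.inl x) rfl
  obtain ⟨y, -, hy⟩ := hC h1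
  exact absurd hy (by simp)

end Units

section Diagrams

/-- A planar diagram in `m` colours with top row `X` and bottom row `Y`: a colouring of the nodes
and a partition of the nodes into monochromatic blocks of size two, such that edges of the same
colour do not cross. -/
@[ext] structure Diagram (X Y : Type) [LinearOrder X] [LinearOrder Y] (m : ℕ) where
  top : X → Fin m
  bot : Y → Fin m
  rel : Setoid (X ⊕ Y)
  colour : rel ≤ Setoid.ker (Sum.elim top bot)
  pairing : IsPairing rel
  planar : IsPlanar rel (Sum.elim top bot)

variable {m : ℕ} {X Y Z W : Type} [LinearOrder X] [LinearOrder Y] [LinearOrder Z] [LinearOrder W]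

/-- The diagram obtained by placing `d` above `e`. -/
def Diagram.comp [Finite X] [Finite Y] [Finite Z] (d : Diagram X Y m) (e : Diagram Y Z m)
    (h : d.bot = e.top) : Diagram X Z m where
  top := d.top
  bot := e.bot
  rel := compRel d.rel e.rel
  colour := by
    have hg : glue d.rel e.rel ≤ Setoid.ker (Sum.elim d.top (Sum.elim d.bot e.bot)) := by
      rw [glue_le_iff]
      refine ⟨fun {a b} hab => ?_, fun {a b} hab => ?_⟩
      · have := d.colour hab
        rcases a with a | a <;> rcases b with b | b <;> exact this
      · have := e.colour hab
        rw [← h] at this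
        rcases a with a | a <;> rcases b with b | b <;> exact this
    intro a b hab
    have := hg hab
    rcases a with a | a <;> rcases b with b | b <;> exact this
  pairing := compRel_isPairing d.pairing e.pairing
  planar := compRel_isPlanar d.pairing e.pairing d.top e.top e.bot (h ▸ d.colour) e.colour
    (h ▸ d.planar) e.planar

/-- The diagram in which every node is joined to the node below it. -/
def Diagram.one (c : X → Fin m) : Diagram X X m where
  top := c
  bot := c
  rel := Setoid.ker (Sum.elim id id)
  colour := by
    intro a b hab
    change Sum.elim c c a = Sum.elim c c b
    have : (Sum.elim id id a : X) = Sum.elim id id b := hab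
    rcases a with a | a <;> rcases b with b | b <;> exact congrArg c this
  pairing := by
    intro a
    rcases a with x | x
    · refine ⟨Sum.inr x, ⟨by simp, rfl⟩, ?_⟩
      rintro (y | y) ⟨h1, h2⟩
      · exact absurd (congrArg Sum.inl (show x = y from h2)).symm h1
      · rw [show x = y from h2]
    · refine ⟨Sum.inl x, ⟨by simp, rfl⟩, ?_⟩
      rintro (y | y) ⟨h1, h2⟩
      · rw [show x = y from h2]
      · exact absurd (congrArg Sum.inr (show x = y from h2)).symm h1
  planar := by
    intro a b c d hab hbc hcd hac hbd
    rcases a with a | a <;> rcases b with b | b <;> rcases c with c | c <;> rcases d with d | d <;>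
      simp_all [Setoid.ker_def]
    all_goals exact absurd ‹c < d› (lt_asymm ‹d < c›)

/-- The monomial that replaces the closed loops of the concatenation of `d` and `e`: a factor
`δ j` for each loop of colour `j`. -/
noncomputable def loopWeight (δ : Fin m → ℂ) (d : Diagram X Y m) (e : Diagram Y Z m) : ℂ :=
  ∏ j, δ j ^ loops d.rel e.rel {y | d.bot y = j}

variable [Finite X] [Finite Y] [Finite Z] [Finite W]

open Classical in
/-- The product of two diagrams: zero unless the colours of the rows that meet agree. -/
noncomputable def diagramMul (δ : Fin m → ℂ) (d : Diagram X Y m) (e : Diagram Y Z m) :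
    Diagram X Z m →₀ ℂ :=
  if h : d.bot = e.top then Finsupp.single (d.comp e h) (loopWeight δ d e) else 0

/-- The bilinear extension of the product of diagrams. -/
noncomputable def linMul (δ : Fin m → ℂ) :
    (Diagram X Y m →₀ ℂ) →ₗ[ℂ] (Diagram Y Z m →₀ ℂ) →ₗ[ℂ] (Diagram X Z m →₀ ℂ) :=
  Finsupp.linearCombination ℂ fun d => Finsupp.linearCombination ℂ fun e => diagramMul δ d e

theorem linMul_single (δ : Fin m → ℂ) (d : Diagram X Y m) (e : Diagram Y Z m) :
    linMul δ (Finsupp.single d 1) (Finsupp.single e 1) = diagramMul δ d e := by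
  simp [linMul]

theorem single_eq_smul {A : Type} (a : A) (c : ℂ) :
    Finsupp.single a c = c • Finsupp.single a (1 : ℂ) := by simp

theorem linMul_assoc (δ : Fin m → ℂ) (a : Diagram X Y m →₀ ℂ) (b : Diagram Y Z m →₀ ℂ)
    (c : Diagram Z W m →₀ ℂ) : linMul δ (linMul δ a b) c = linMul δ a (linMul δ b c) := by
  induction a using Finsupp.induction_linear with
  | zero => simp
  | add f g hf hg => simp only [map_add, LinearMap.add_apply, hf, hg]
  | single d x =>
    rw [single_eq_smul d x]
    simp only [map_smul, LinearMap.smul_apply]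
    congr 1
    induction b using Finsupp.induction_linear with
    | zero => simp
    | add f g hf hg => simp only [map_add, LinearMap.add_apply, hf, hg]
    | single e y =>
      rw [single_eq_smul e y]
      simp only [map_smul, LinearMap.smul_apply]
      congr 1
      induction c using Finsupp.induction_linear with
      | zero => simp
      | add f g hf hg => simp only [map_add, hf, hg]
      | single f z =>
        rw [single_eq_smul f z]
        simp only [map_smul]
        refine congrArg (fun w : Diagram X W m →₀ ℂ => z • w) ?_
        rw [linMul_single, linMul_single]
        by_cases h1 : d.bot = e.top
        · by_cases h2 : e.bot = f.top
          · have h3 : (d.comp e h1).bot = f.top := h2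
            have h4 : d.bot = (e.comp f h2).top := h1
            rw [diagramMul, diagramMul, dif_pos h1, dif_pos h2, single_eq_smul (d.comp e h1),
              single_eq_smul (e.comp f h2)]
            simp only [map_smul, LinearMap.smul_apply]
            rw [linMul_single, linMul_single, diagramMul, diagramMul, dif_pos h3, dif_pos h4,
              Finsupp.smul_single, Finsupp.smul_single, smul_eq_mul, smul_eq_mul]
            have hc : (d.comp e h1).comp f h3 = d.comp (e.comp f h2) h4 :=
              Diagram.ext rfl rfl (compRel_assoc _ _ _)
            have hw : loopWeight δ d e * loopWeight δ (d.comp e h1) f =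
                loopWeight δ e f * loopWeight δ d (e.comp f h2) := by
              simp only [loopWeight, ← Finset.prod_mul_distrib, ← pow_add]
              refine Finset.prod_congr rfl fun j _ => ?_
              congr 1
              exact loops_assoc d.rel e.rel f.rel d.top d.bot e.bot f.bot d.colour
                (h1 ▸ e.colour) (h2 ▸ f.colour) j
            rw [hc, hw]
          · rw [diagramMul, diagramMul, dif_pos h1, dif_neg h2, single_eq_smul (d.comp e h1)]
            simp only [map_smul, map_zero, LinearMap.smul_apply]
            rw [linMul_single, diagramMul, dif_neg (show ¬ (d.comp e h1).bot = f.top from h2),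
              smul_zero]
        · by_cases h2 : e.bot = f.top
          · rw [diagramMul, diagramMul, dif_neg h1, dif_pos h2, single_eq_smul (e.comp f h2)]
            simp only [map_smul, map_zero, LinearMap.zero_apply]
            rw [linMul_single, diagramMul, dif_neg (show ¬ d.bot = (e.comp f h2).top from h1),
              smul_zero]
          · rw [diagramMul, diagramMul, dif_neg h1, dif_neg h2]
            simp

open Classical in
theorem diagramMul_one_left (δ : Fin m → ℂ) (c : X → Fin m) (e : Diagram X Y m) :
    diagramMul δ (Diagram.one c) e = if c = e.top then Finsupp.single e 1 else 0 := by
  by_cases h : c = e.top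
  · have h' : (Diagram.one c).bot = e.top := h
    rw [diagramMul, dif_pos h', if_pos h]
    have h1 : (Diagram.one c).comp e h' = e := Diagram.ext h rfl (compRel_one_left _)
    have h2 : loopWeight δ (Diagram.one c) e = 1 := by
      simp [loopWeight, Diagram.one, loops_one_left]
    rw [h1, h2]
  · rw [diagramMul, dif_neg (show ¬ (Diagram.one c).bot = e.top from h), if_neg h]

open Classical in
theorem diagramMul_one_right (δ : Fin m → ℂ) (c : Y → Fin m) (d : Diagram X Y m) :
    diagramMul δ d (Diagram.one c) = if c = d.bot then Finsupp.single d 1 else 0 := by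
  by_cases h : c = d.bot
  · have h' : d.bot = (Diagram.one c).top := h.symm
    rw [diagramMul, dif_pos h', if_pos h]
    have h1 : d.comp (Diagram.one c) h' = d := Diagram.ext rfl h (compRel_one_right _)
    have h2 : loopWeight δ d (Diagram.one c) = 1 := by
      simp [loopWeight, Diagram.one, loops_one_right]
    rw [h1, h2]
  · rw [diagramMul, dif_neg (fun h' : d.bot = (Diagram.one c).top => h h'.symm), if_neg h]

theorem linMul_one_left {n : ℕ} (δ : Fin m → ℂ) (a : Diagram (Fin n) Y m →₀ ℂ) :
    linMul δ (∑ c : Fin n → Fin m, Finsupp.single (Diagram.one c) 1) a = a := by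
  classical
  induction a using Finsupp.induction_linear with
  | zero => simp
  | add f g hf hg => rw [map_add, hf, hg]
  | single e x =>
    rw [single_eq_smul, map_smul]
    congr 1
    rw [map_sum, LinearMap.sum_apply]
    have h : ∀ c : Fin n → Fin m, linMul δ (Finsupp.single (Diagram.one c) 1)
        (Finsupp.single e 1) = if c = e.top then Finsupp.single e 1 else 0 := fun c => by
      rw [linMul_single, diagramMul_one_left]
      congr
    rw [Finset.sum_congr rfl fun c _ => h c]
    simp

theorem linMul_one_right {n : ℕ} (δ : Fin m → ℂ) (a : Diagram X (Fin n) m →₀ ℂ) :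
    linMul δ a (∑ c : Fin n → Fin m, Finsupp.single (Diagram.one c) 1) = a := by
  classical
  induction a using Finsupp.induction_linear with
  | zero => simp
  | add f g hf hg => rw [map_add, LinearMap.add_apply, hf, hg]
  | single e x =>
    rw [single_eq_smul, map_smul, LinearMap.smul_apply]
    congr 1
    rw [map_sum]
    have h : ∀ c : Fin n → Fin m, linMul δ (Finsupp.single e 1)
        (Finsupp.single (Diagram.one c) 1) = if c = e.bot then Finsupp.single e 1 else 0 :=
      fun c => by
        rw [linMul_single, diagramMul_one_right]
        congr
    rw [Finset.sum_congr rfl fun c _ => h c]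
    simp

end Diagrams

section Algebra

variable {m : ℕ}

/-- The bubble algebra `T_{n,m}(δ_0, …, δ_{m-1})`: the complex vector space with basis the
planar `m`-coloured diagrams with `n` nodes in each row. -/
def BubbleAlgebra (n : ℕ) {m : ℕ} (_δ : Fin m → ℂ) : Type := Diagram (Fin n) (Fin n) m →₀ ℂ

noncomputable instance (n : ℕ) (δ : Fin m → ℂ) : AddCommGroup (BubbleAlgebra n δ) :=
  inferInstanceAs (AddCommGroup (Diagram (Fin n) (Fin n) m →₀ ℂ))

noncomputable instance (n : ℕ) (δ : Fin m → ℂ) : Module ℂ (BubbleAlgebra n δ) :=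
  inferInstanceAs (Module ℂ (Diagram (Fin n) (Fin n) m →₀ ℂ))

/-- The product `a * b` places `a` above `b`; the identity is the sum of all colourings of the
identity diagram. -/
noncomputable instance (n : ℕ) (δ : Fin m → ℂ) : Ring (BubbleAlgebra n δ) where
  __ := (inferInstance : AddCommGroup (BubbleAlgebra n δ))
  mul a b := linMul (X := Fin n) (Y := Fin n) (Z := Fin n) δ a b
  one := ∑ c : Fin n → Fin m, Finsupp.single (Diagram.one c) (1 : ℂ)
  left_distrib a b c := map_add (linMul (X := Fin n) (Y := Fin n) (Z := Fin n) δ a) b c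
  right_distrib a b c :=
    LinearMap.map_add₂ (linMul (X := Fin n) (Y := Fin n) (Z := Fin n) δ) a b c
  zero_mul a := LinearMap.map_zero₂ (linMul (X := Fin n) (Y := Fin n) (Z := Fin n) δ) a
  mul_zero a := map_zero (linMul (X := Fin n) (Y := Fin n) (Z := Fin n) δ a)
  mul_assoc a b c := linMul_assoc δ a b c
  one_mul a := linMul_one_left δ a
  mul_one a := linMul_one_right δ a

noncomputable instance (n : ℕ) (δ : Fin m → ℂ) : Algebra ℂ (BubbleAlgebra n δ) :=
  Algebra.ofModule
    (fun c a b => LinearMap.map_smul₂ (linMul (X := Fin n) (Y := Fin n) (Z := Fin n) δ) c a b)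
    (fun c a b => map_smul (linMul (X := Fin n) (Y := Fin n) (Z := Fin n) δ a) c b)

end Algebra

section Cell

variable {m : ℕ}

/-- The places where the propagating lines of a diagram are cut: `lam j` of them for each
colour `j`. -/
abbrev CutPoints (lam : Fin m → ℕ) : Type := Σₗ j : Fin m, Fin (lam j)

/-- `d` is the top half of a diagram with exactly `lam j` propagating lines of each colour `j`:
the bottom row consists of the cut points, and each of them is joined to a node of the top row. -/
def IsHalf {n : ℕ} {lam : Fin m → ℕ} (d : Diagram (Fin n) (CutPoints lam) m) : Prop :=
  d.bot = (fun y => (ofLex y).1) ∧ ∀ y, ∃ x, d.rel (Sum.inr y) (Sum.inl x)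

/-- Half-diagrams (link states) with `n` nodes and `lam j` defects of each colour `j`. -/
abbrev HalfDiagram (n : ℕ) (lam : Fin m → ℕ) : Type :=
  {d : Diagram (Fin n) (CutPoints lam) m // IsHalf d}

variable (n : ℕ) (δ : Fin m → ℂ) (lam : Fin m → ℕ)

/-- Half-diagrams inside the space spanned by all diagrams with `n` nodes in the top row and the
cut points in the bottom row. -/
noncomputable def ofHalf :
    (HalfDiagram n lam →₀ ℂ) →ₗ[ℂ] (Diagram (Fin n) (CutPoints lam) m →₀ ℂ) :=
  Finsupp.linearCombination ℂ fun x => Finsupp.single x.1 1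

open Classical in
/-- The projection that kills every diagram in which not all cut points are joined to the top. -/
noncomputable def toHalf :
    (Diagram (Fin n) (CutPoints lam) m →₀ ℂ) →ₗ[ℂ] (HalfDiagram n lam →₀ ℂ) :=
  Finsupp.linearCombination ℂ fun d => if h : IsHalf d then Finsupp.single ⟨d, h⟩ 1 else 0

theorem toHalf_single_pos (d : Diagram (Fin n) (CutPoints lam) m) (h : IsHalf d) :
    toHalf n lam (Finsupp.single d 1) = Finsupp.single ⟨d, h⟩ 1 := by
  rw [toHalf, Finsupp.linearCombination_single, one_smul, dif_pos h]

theorem toHalf_single_neg (d : Diagram (Fin n) (CutPoints lam) m) (h : ¬ IsHalf d) (c : ℂ) :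
    toHalf n lam (Finsupp.single d c) = 0 := by
  rw [toHalf, Finsupp.linearCombination_single, dif_neg h, smul_zero]

theorem ofHalf_single (d : HalfDiagram n lam) :
    ofHalf n lam (Finsupp.single d 1) = Finsupp.single d.1 1 := by
  rw [ofHalf, Finsupp.linearCombination_single, one_smul]

theorem toHalf_ofHalf (x : HalfDiagram n lam →₀ ℂ) : toHalf n lam (ofHalf n lam x) = x := by
  induction x using Finsupp.induction_linear with
  | zero => rw [map_zero, map_zero]
  | add f g hf hg => rw [map_add, map_add, hf, hg]
  | single d c =>
    rw [single_eq_smul, map_smul, map_smul, ofHalf_single, toHalf_single_pos n lam d.1 d.2]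

theorem compRel_propagating {X Y Z : Type} (r : Setoid (X ⊕ Y)) (s : Setoid (Y ⊕ Z)) (z : Z)
    (h : ∃ x, compRel r s (Sum.inr z) (Sum.inl x)) : ∃ y, s (Sum.inr z) (Sum.inl y) := by
  by_contra hno
  obtain ⟨x, hx⟩ := h
  let O : Set (X ⊕ (Y ⊕ Z)) := {a | ∃ z', a = lower (Sum.inr z') ∧ s (Sum.inr z) (Sum.inr z')}
  have hO : glue r s ≤ Setoid.ker (fun a => a ∈ O) := by
    rw [glue_le_iff]
    refine ⟨fun {a b} hab => ?_, fun {a b} hab => ?_⟩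
    · have : ∀ a : X ⊕ Y, ¬ (upper a ∈ O) := by
        rintro (a | a) ⟨z', h1, -⟩ <;> simp [upper, lower] at h1
      exact propext ⟨fun h => absurd h (this a), fun h => absurd h (this b)⟩
    · have key : ∀ a b : Y ⊕ Z, s a b → lower a ∈ O → (lower b : X ⊕ (Y ⊕ Z)) ∈ O := by
        rintro a b hab ⟨z', h1, h2⟩
        have h3 : a = Sum.inr z' := Sum.inr_injective h1
        subst h3
        have h4 := s.trans' h2 hab
        rcases b with y | z''
        · exact absurd ⟨y, h4⟩ hno
        · exact ⟨z'', rfl, h4⟩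
      exact propext ⟨key a b hab, key b a (s.symm' hab)⟩
  have h1 : (outer (Sum.inr z) : X ⊕ (Y ⊕ Z)) ∈ O := ⟨z, rfl, s.refl' _⟩
  have h2 : (outer (Sum.inl x) : X ⊕ (Y ⊕ Z)) ∈ O := (hO hx).mp h1
  obtain ⟨z', h3, -⟩ := h2
  simp [outer, lower] at h3

theorem toHalf_linMul (a : Diagram (Fin n) (Fin n) m →₀ ℂ)
    (w : Diagram (Fin n) (CutPoints lam) m →₀ ℂ) :
    toHalf n lam (linMul δ a (ofHalf n lam (toHalf n lam w))) = toHalf n lam (linMul δ a w) := by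
  induction w using Finsupp.induction_linear with
  | zero => simp only [map_zero]
  | add f g hf hg => simp only [map_add, hf, hg]
  | single e y =>
    rw [single_eq_smul]
    simp only [map_smul]
    refine congrArg (y • ·) ?_
    by_cases h : IsHalf e
    · rw [toHalf_single_pos n lam e h, ofHalf_single]
    · rw [toHalf_single_neg n lam e h, map_zero, map_zero, map_zero]
      symm
      induction a using Finsupp.induction_linear with
      | zero => simp only [map_zero, LinearMap.zero_apply]
      | add f g hf hg => simp only [map_add, LinearMap.add_apply, hf, hg, add_zero]
      | single d x =>
        rw [single_eq_smul]
        simp only [map_smul, LinearMap.smul_apply]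
        rw [linMul_single, diagramMul]
        by_cases hde : d.bot = e.top
        · have h2 : ¬ IsHalf (d.comp e hde) := by
            rintro ⟨h3, h4⟩
            exact h ⟨h3, fun y => compRel_propagating _ _ y (h4 y)⟩
          rw [dif_pos hde, toHalf_single_neg n lam _ h2, smul_zero]
        · rw [dif_neg hde, map_zero, smul_zero]

/-- The action of the algebra on half-diagrams by concatenation, where closed loops are replaced
by parameters; the result is zero if the colours do not match or a propagating line is lost. -/
noncomputable def halfAction :
    (Diagram (Fin n) (Fin n) m →₀ ℂ) →ₗ[ℂ] (HalfDiagram n lam →₀ ℂ) →ₗ[ℂ]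
      (HalfDiagram n lam →₀ ℂ) :=
  (linMul δ).compl₁₂ LinearMap.id (ofHalf n lam) |>.compr₂ (toHalf n lam)

theorem halfAction_apply (a : Diagram (Fin n) (Fin n) m →₀ ℂ) (x : HalfDiagram n lam →₀ ℂ) :
    halfAction n δ lam a x = toHalf n lam (linMul δ a (ofHalf n lam x)) := rfl

/-- The cell module `Δ_n(lam)` of `T_{n,m}(δ)`, with basis the half-diagrams. -/
def Cell (n : ℕ) {m : ℕ} (_δ : Fin m → ℂ) (lam : Fin m → ℕ) : Type := HalfDiagram n lam →₀ ℂ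

noncomputable instance : AddCommGroup (Cell n δ lam) :=
  inferInstanceAs (AddCommGroup (HalfDiagram n lam →₀ ℂ))

noncomputable instance : Module ℂ (Cell n δ lam) :=
  inferInstanceAs (Module ℂ (HalfDiagram n lam →₀ ℂ))

noncomputable instance : Module (BubbleAlgebra n δ) (Cell n δ lam) where
  smul a x := halfAction n δ lam a x
  one_smul x := (congrArg _ (linMul_one_left δ (ofHalf n lam x))).trans (toHalf_ofHalf n lam x)
  mul_smul a b x := (congrArg _ (linMul_assoc δ a b (ofHalf n lam x))).trans
    (toHalf_linMul n δ lam a (linMul δ b (ofHalf n lam x))).symm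
  smul_zero a := map_zero (halfAction n δ lam a)
  smul_add a x y := map_add (halfAction n δ lam a) x y
  add_smul a b x := LinearMap.map_add₂ (halfAction n δ lam) a b x
  zero_smul x := LinearMap.map_zero₂ (halfAction n δ lam) x

instance : IsScalarTower ℂ (BubbleAlgebra n δ) (Cell n δ lam) where
  smul_assoc c a x := LinearMap.map_smul₂ (halfAction n δ lam) c a x

/-- The head `L_n(lam)` of the cell module: the quotient by the intersection of all maximal
submodules. -/
abbrev Head : Type := Cell n δ lam ⧸ Module.jacobson (BubbleAlgebra n δ) (Cell n δ lam)

open Classical in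
/-- The inner product of two half-diagrams: reflect `x` and place it above `y`. The value is zero
unless the colours of the nodes agree and every defect of `x` ends up connected to a defect
of `y`; then each closed loop of colour `j` contributes a factor `δ j`. -/
noncomputable def gram {n : ℕ} {lam : Fin m → ℕ} (δ : Fin m → ℂ) (x y : HalfDiagram n lam) : ℂ :=
  if x.1.top = y.1.top ∧ ∀ a : CutPoints lam, ∃ b : CutPoints lam,
      compRel (x.1.rel.comap Sum.swap) y.1.rel (Sum.inl a) (Sum.inr b)
  then ∏ j, δ j ^ loops (x.1.rel.comap Sum.swap) y.1.rel {i | x.1.top i = j}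
  else 0

/-- The inner product on the cell module `Δ_n(lam)`. -/
noncomputable def cellForm : LinearMap.BilinForm ℂ (Cell n δ lam) :=
  (Finsupp.linearCombination ℂ fun x => Finsupp.linearCombination ℂ fun y => gram δ x y :
    (HalfDiagram n lam →₀ ℂ) →ₗ[ℂ] (HalfDiagram n lam →₀ ℂ) →ₗ[ℂ] ℂ)

end Cell

section TemperleyLieb

/-- The cell module `V_{k,p}` of the Temperley-Lieb algebra `TL_k(δ)`, for `2 * p ≤ k`: it is
spanned by the link states with `k` nodes and `p` arcs, hence `k - 2 * p` defects. The algebra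
`TL_k(δ)` is the bubble algebra in a single colour. -/
abbrev TLCell (k p : ℕ) (δ : ℂ) : Type := Cell k (fun _ : Fin 1 => δ) (fun _ => k - 2 * p)

/-- The space `L_{k,p,δ}`: the quotient of `V_{k,p}` by the radical of its inner product. -/
abbrev TLHead (k p : ℕ) (δ : ℂ) : Type :=
  TLCell k p δ ⧸ LinearMap.ker (cellForm k (fun _ : Fin 1 => δ) (fun _ => k - 2 * p))

end TemperleyLieb

/-- The set `Γ_{(v,m)}` of `m`-tuples of non-negative integers with sum `v`. -/
def Gam (v m : ℕ) : Finset (Fin m → ℕ) := Finset.piAntidiag Finset.univ v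

/-- The multinomial coefficient `n_μ`, where `μ = lam + 2u`. -/
def multi {m : ℕ} (lam u : Fin m → ℕ) : ℕ :=
  Nat.multinomial Finset.univ fun i => lam i + 2 * u i

end Bubble

/-! The proof has two independent halves, both resting on the bilinear form.

Simplicity is the usual cell-module argument. Planarity within each colour leaves only one diagram
on the cut points that keeps the colours and loses no line, namely the identity
(`Diagram.eq_one_of_bot_propagating`). Hence `⟨x, y⟩` is the coefficient of that identity in the
product of the reflected `x` with `y` (`gram_eq_diagramMul`), and associativity of concatenation
gives two facts: the radical is a submodule, and the algebra element "`x` above the reflection of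
`z`" sends `b` to `⟨z, b⟩ x` (`rankOne_smul`). So anything outside the radical generates the whole
cell module. If the form is not zero, the radical is the unique maximal submodule, and the head is
the quotient by it.

For the dimension, this quotient has dimension the rank of the Gram matrix
(`finrank_quotient_ker_form`). A half-diagram is a colouring of the nodes together with one link
state for each colour, since edges of different colours do not interact (`ofSplit_bijective`).
Half-diagrams with different colourings are orthogonal; for a fixed colouring, defects and loops are
counted colour by colour, so the form is a product of Temperley–Lieb forms (`gram_assembleHalf`).
The Gram matrix is therefore block diagonal, each block being a Kronecker product. Ranks add over
blocks and multiply over Kronecker factors, and the number of blocks belonging to `u` is a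
multinomial coefficient.

The asserted isomorphism is one of complex vector spaces, so it follows from equality of finite
dimensions. -/

/-! ### Ranks of Kronecker products and of block diagonal matrices. -/

/-- A matrix that factors through `ρ`, and from which the identity of `ρ` can be recovered,
has rank `card ρ`. -/
theorem Matrix.rank_eq_card_of_factorization {K B ρ : Type*} [Field K] [Fintype B] [DecidableEq ρ]
    [Fintype ρ] {M : Matrix B B K} {P : Matrix B ρ K} {Q : Matrix ρ B K} {P' : Matrix ρ B K}
    {Q' : Matrix B ρ K} (h : M = P * Q) (h' : P' * M * Q' = 1) : M.rank = Fintype.card ρ := by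
  apply le_antisymm
  · rw [h]
    exact (Matrix.rank_mul_le_left P Q).trans (Matrix.rank_le_card_width P)
  · rw [← Matrix.rank_one (R := K) (n := ρ), ← h']
    exact (Matrix.rank_mul_le_left _ _).trans (Matrix.rank_mul_le_right _ _)

/-- Every square matrix over a field has a rank factorization. -/
theorem Matrix.exists_rank_factorization {K B : Type*} [Field K] [Fintype B] (M : Matrix B B K) :
    ∃ (P : Matrix B (Fin M.rank) K) (Q : Matrix (Fin M.rank) B K)
      (P' : Matrix (Fin M.rank) B K) (Q' : Matrix B (Fin M.rank) K),
      M = P * Q ∧ P' * M * Q' = 1 := by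
  classical
  obtain ⟨V, U, e, hV, hU, h⟩ := M.exists_rank_normal_form
  have hV' := (Matrix.isUnit_iff_isUnit_det V).1 hV
  have hU' := (Matrix.isUnit_iff_isUnit_det U).1 hU
  -- `I` and `J` are the inclusion of, and the projection to, the coordinates of the identity block:
  -- the normal form is `I * J`, while `J * I = 1`.
  let I : Matrix B (Fin M.rank) K := Matrix.of fun b t => if e b = Sum.inl t then 1 else 0
  let J : Matrix (Fin M.rank) B K := Matrix.of fun t b => if e b = Sum.inl t then 1 else 0
  have hIJ : (Matrix.fromBlocks 1 0 0 0).submatrix e e = I * J := by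
    ext b b'
    rw [Matrix.submatrix_apply, Matrix.mul_apply]
    simp only [I, J, Matrix.of_apply]
    rcases e b with t | t <;> rcases e b' with t' | t' <;> simp [Matrix.one_apply, eq_comm]
  have hJI : J * I = 1 := by
    ext t t'
    rw [Matrix.mul_apply, ← e.symm.sum_comp]
    simp [I, J, Matrix.one_apply, eq_comm]
  rw [hIJ] at h
  refine ⟨V⁻¹ * I, J * U⁻¹, J * V, U * I, ?_, ?_⟩
  · have h1 : V⁻¹ * (V * M * U) * U⁻¹ = M := by
      rw [Matrix.mul_assoc V, Matrix.nonsing_inv_mul_cancel_left _ _ hV',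
        Matrix.mul_nonsing_inv_cancel_right _ _ hU']
    calc M = V⁻¹ * (I * J) * U⁻¹ := by rw [← h, h1]
      _ = _ := by simp only [Matrix.mul_assoc]
  · have h1 : J * V * M * (U * I) = J * (V * M * U) * I := by simp only [Matrix.mul_assoc]
    rw [h1, h, ← Matrix.mul_assoc J, hJI, Matrix.one_mul, hJI]

/-- The Kronecker product of a family of matrices. -/
def Matrix.piKronecker {K ι : Type*} [CommSemiring K] [Fintype ι] {B R : ι → Type*}
    (M : ∀ i, Matrix (B i) (R i) K) : Matrix (∀ i, B i) (∀ i, R i) K :=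
  fun x y => ∏ i, M i (x i) (y i)

/-- The middle index is a choice function, and summing over choice functions expands a product of
sums. -/
theorem Matrix.piKronecker_mul {K ι : Type*} [CommSemiring K] [Fintype ι] [DecidableEq ι]
    {B R S : ι → Type*} [∀ i, Fintype (R i)] (M : ∀ i, Matrix (B i) (R i) K)
    (N : ∀ i, Matrix (R i) (S i) K) :
    piKronecker M * piKronecker N = piKronecker fun i => M i * N i := by
  ext x y
  simp only [Matrix.mul_apply, piKronecker, Finset.prod_univ_sum, Fintype.piFinset_univ,
    Finset.prod_mul_distrib]

theorem Matrix.piKronecker_one {K ι : Type*} [CommSemiring K] [Fintype ι]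
    {B : ι → Type*} [∀ i, DecidableEq (B i)] [DecidableEq (∀ i, B i)] :
    piKronecker (fun i => (1 : Matrix (B i) (B i) K)) = 1 := by
  ext x y
  simp only [piKronecker, Matrix.one_apply]
  by_cases h : x = y
  · subst h; simp
  · obtain ⟨i, hi⟩ := Function.ne_iff.1 h
    rw [if_neg h, Finset.prod_eq_zero (Finset.mem_univ i) (if_neg hi)]

/-- Kronecker products of rank factorizations are again a factorization together with a recovery of
the identity; its middle index runs over choice functions, whose number is the product of the ranks.
-/
theorem Matrix.rank_piKronecker {K ι : Type*} [Field K] [Fintype ι]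
    {B : ι → Type*} [∀ i, Fintype (B i)] [Fintype (∀ i, B i)] (M : ∀ i, Matrix (B i) (B i) K) :
    (piKronecker M).rank = ∏ i, (M i).rank := by
  classical
  choose P Q P' Q' h h' using fun i => (M i).exists_rank_factorization
  have h1 : piKronecker M = piKronecker P * piKronecker Q := by
    rw [piKronecker_mul]
    exact congrArg _ (funext h)
  have h2 : piKronecker P' * piKronecker M * piKronecker Q' = 1 := by
    -- The finiteness of the product type is a hypothesis here, so it is first identified with the
    -- canonical instance, which the product formula uses.
    have : ‹Fintype (∀ i, B i)› = Pi.instFintype := Subsingleton.elim _ _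
    subst this
    rw [piKronecker_mul, piKronecker_mul, ← piKronecker_one]
    exact congrArg _ (funext h')
  rw [Matrix.rank_eq_card_of_factorization h1 h2, Fintype.card_pi]
  simp

/-- As for Kronecker products, but the middle index is now a disjoint union, so the ranks add. -/
theorem Matrix.rank_blockDiagonal' {K ι : Type*} [Field K] [Fintype ι] [DecidableEq ι]
    {B : ι → Type*} [∀ i, Fintype (B i)] (M : ∀ i, Matrix (B i) (B i) K) :
    (blockDiagonal' M).rank = ∑ i, (M i).rank := by
  choose P Q P' Q' h h' using fun i => (M i).exists_rank_factorization
  have h1 : blockDiagonal' M = blockDiagonal' P * blockDiagonal' Q := by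
    rw [← blockDiagonal'_mul]
    exact congrArg _ (funext h)
  have h2 : blockDiagonal' P' * blockDiagonal' M * blockDiagonal' Q' = 1 := by
    rw [← blockDiagonal'_mul, ← blockDiagonal'_mul, ← blockDiagonal'_one]
    exact congrArg _ (funext h')
  rw [Matrix.rank_eq_card_of_factorization h1 h2, Fintype.card_sigma]
  simp

/-! ### Dimensions of tensor products and of quotients by radicals; counting colourings. -/

theorem finrank_piTensorProduct {K ι : Type*} [Field K] [Fintype ι] (V : ι → Type*)
    [∀ i, AddCommGroup (V i)] [∀ i, Module K (V i)] [∀ i, Module.Finite K (V i)] :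
    Module.finrank K (PiTensorProduct K V) = ∏ i, Module.finrank K (V i) := by
  classical
  rw [Module.finrank_eq_card_basis (Basis.piTensorProduct fun i => Module.finBasis K (V i)),
    Fintype.card_pi]
  simp

/-- The quotient by the left radical of the form with a given Gram matrix. -/
theorem finrank_quotient_ker_form {K B : Type*} [Field K] [Fintype B]
    (f : (B →₀ K) →ₗ[K] (B →₀ K) →ₗ[K] K) (M : Matrix B B K)
    (h : ∀ x y, f (Finsupp.single x 1) (Finsupp.single y 1) = M x y) :
    Module.finrank K ((B →₀ K) ⧸ LinearMap.ker f) = M.rank := by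
  classical
  -- The quotient is the range of `f` as a map into the dual space. With respect to the basis and
  -- its dual basis, column `x` of the matrix of `f` lists the values `f x y`, so this matrix is the
  -- transpose of `M`.
  rw [f.quotKerEquivRange.finrank_eq, ← Matrix.rank_transpose,
    Matrix.rank_eq_finrank_range_toLin M.transpose
      (Finsupp.basisSingleOne (R := K) (ι := B)).dualBasis Finsupp.basisSingleOne]
  have : f = Matrix.toLin Finsupp.basisSingleOne
      (Finsupp.basisSingleOne (R := K) (ι := B)).dualBasis M.transpose := by
    refine Finsupp.basisSingleOne.ext fun x => Finsupp.basisSingleOne.ext fun y => ?_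
    rw [Matrix.toLin_self]
    simp [h, Finsupp.single_apply]
  rw [← this]

open MvPolynomial in
/-- The number of colourings with prescribed sizes of the colour classes. -/
theorem card_colourings (n : ℕ) {ι : Type*} [Fintype ι] [DecidableEq ι] (μ : ι → ℕ)
    (hμ : ∑ i, μ i = n) :
    Nat.card {c : Fin n → ι // ∀ j, Fintype.card {i // c i = j} = μ j} =
      Nat.multinomial Finset.univ μ := by
  -- The power of the sum of the variables is expanded once into words and once by the multinomial
  -- theorem; comparing the coefficients at `μ` counts the words of content `μ`.
  have h1 : (∑ i : ι, (X i : MvPolynomial ι ℕ)) ^ n =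
      ∑ c : Fin n → ι, monomial (∑ i, Finsupp.single (c i) 1) 1 := by
    rw [← Fin.prod_const, Finset.prod_univ_sum, Fintype.piFinset_univ]
    refine Finset.sum_congr rfl fun c _ => ?_
    simp only [X]
    rw [monomial_sum_one]
  have h2 : (∑ i : ι, (X i : MvPolynomial ι ℕ)) ^ n =
      ∑ k ∈ Finset.piAntidiag Finset.univ n,
        monomial (Finsupp.equivFunOnFinite.symm k) (Nat.multinomial Finset.univ k) := by
    rw [Finset.sum_pow_eq_sum_piAntidiag]
    refine Finset.sum_congr rfl fun k _ => ?_
    rw [monomial_eq, Finsupp.prod_fintype _ _ (fun i => by simp)]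
    simp
  have h3 := congrArg (coeff (Finsupp.equivFunOnFinite.symm μ)) (h1.symm.trans h2)
  simp only [coeff_sum, coeff_monomial, EmbeddingLike.apply_eq_iff_eq] at h3
  rw [Finset.sum_ite_eq' (Finset.piAntidiag Finset.univ n) μ,
    if_pos (by simp [hμ]), Finset.sum_boole] at h3
  rw [← h3, Nat.card_eq_fintype_card, Fintype.card_subtype, Nat.cast_id]
  congr 1
  ext c
  simp only [Finset.mem_filter, Finset.mem_univ, true_and, Finsupp.ext_iff,
    Finsupp.equivFunOnFinite_symm_apply_apply, Finsupp.finsetSum_apply, Finsupp.single_apply,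
    Finset.sum_boole, Fintype.card_subtype, Nat.cast_id]

namespace Bubble

/-! ### Reflection of diagrams. -/

section Flip

variable {X Y Z : Type}

/-- A block inside `K` contains no point outside the image of `i`, so pulling back loses nothing.
This is `blocksIn_sup_map` with nothing added. -/
theorem blocksIn_comap {A B : Type} [Finite A] (S : Setoid A) (i : B → A) (K : Set A)
    (hKi : K ⊆ Set.range i) (hK : ∀ a p, a ∉ Set.range i → S a (i p) → i p ∉ K) :
    blocksIn S K = blocksIn (S.comap i) (i ⁻¹' K) := by
  have h0 : (⊥ : Setoid B).map i = ⊥ := by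
    rw [eq_bot_iff, map_le_iff]
    exact bot_le
  have h := blocksIn_sup_map S ⊥ i K fun a p ha hap hp => by
    rw [h0, sup_bot_eq] at hap
    exact absurd hp (hK a p ha hap)
  rwa [h0, sup_bot_eq, sup_bot_eq, Set.sdiff_eq_empty.2 hKi, blocksIn_eq_zero, add_zero] at h

/-- Three rows read upside down. -/
def reverseRows : X ⊕ (Y ⊕ Z) → Z ⊕ (Y ⊕ X) :=
  Sum.elim (Sum.inr ∘ Sum.inr) (Sum.elim (Sum.inr ∘ Sum.inl) Sum.inl)

theorem reverseRows_reverseRows (a : X ⊕ (Y ⊕ Z)) : reverseRows (reverseRows a) = a := by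
  rcases a with a | a | a <;> rfl

theorem glue_swap_le (r : Setoid (X ⊕ Y)) (s : Setoid (Y ⊕ Z)) :
    glue r s ≤ (glue (s.comap Sum.swap) (r.comap Sum.swap)).comap reverseRows := by
  rw [glue_le_iff]
  constructor
  · intro a b h
    have := glue_lower (s.comap Sum.swap) (r.comap Sum.swap) (a := a.swap) (b := b.swap)
      (by change r _ _; rwa [Sum.swap_swap, Sum.swap_swap])
    rcases a with a | a <;> rcases b with b | b <;> exact this
  · intro a b h
    have := glue_upper (s.comap Sum.swap) (r.comap Sum.swap) (a := a.swap) (b := b.swap)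
      (by change s _ _; rwa [Sum.swap_swap, Sum.swap_swap])
    rcases a with a | a <;> rcases b with b | b <;> exact this

theorem comap_swap_comap_swap (r : Setoid (X ⊕ Y)) : (r.comap Sum.swap).comap Sum.swap = r := by
  ext a b
  change r _ _ ↔ _
  rw [Sum.swap_swap, Sum.swap_swap]

/-- Reflection is an involution, so `glue_swap_le` for the reflected pair supplies the opposite
inequality. -/
theorem glue_comap_reverseRows (r : Setoid (X ⊕ Y)) (s : Setoid (Y ⊕ Z)) :
    (glue r s).comap reverseRows = glue (s.comap Sum.swap) (r.comap Sum.swap) := by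
  apply le_antisymm
  · intro a b h
    have := glue_swap_le r s h
    change glue _ _ (reverseRows (reverseRows a)) (reverseRows (reverseRows b)) at this
    rwa [reverseRows_reverseRows, reverseRows_reverseRows] at this
  · have := glue_swap_le (s.comap Sum.swap) (r.comap Sum.swap)
    rwa [comap_swap_comap_swap, comap_swap_comap_swap] at this

theorem compRel_comap_swap (r : Setoid (X ⊕ Y)) (s : Setoid (Y ⊕ Z)) :
    (compRel r s).comap Sum.swap = compRel (s.comap Sum.swap) (r.comap Sum.swap) := by
  rw [compRel, compRel, ← glue_comap_reverseRows]
  ext a b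
  rcases a with a | a <;> rcases b with b | b <;> rfl

theorem loops_swap [Finite X] [Finite Y] [Finite Z] (r : Setoid (X ⊕ Y)) (s : Setoid (Y ⊕ Z))
    (K : Set Y) : loops (s.comap Sum.swap) (r.comap Sum.swap) K = loops r s K := by
  have hr : ∀ a : X ⊕ (Y ⊕ Z), a ∈ Set.range (reverseRows : Z ⊕ (Y ⊕ X) → _) :=
    fun a => ⟨_, reverseRows_reverseRows a⟩
  rw [loops, loops, ← glue_comap_reverseRows,
    blocksIn_comap (glue r s) reverseRows _ (fun a _ => hr a) (fun a _ ha => absurd (hr a) ha)]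
  congr 1
  ext a
  rcases a with a | a | a <;> simp [reverseRows]

theorem IsPairing.comap_equiv {A B : Type} {r : Setoid A} (hr : IsPairing r) (e : B ≃ A) :
    IsPairing (r.comap e) := by
  intro b
  obtain ⟨a, ⟨h1, h2⟩, h3⟩ := hr (e b)
  refine ⟨e.symm a, ⟨fun h => h1 (by rw [← h, e.apply_symm_apply]), ?_⟩, fun c hc => ?_⟩
  · change r (e b) (e (e.symm a))
    rwa [e.apply_symm_apply]
  · rw [e.eq_symm_apply]
    exact h3 _ ⟨fun h => hc.1 (e.injective h), hc.2⟩

/-- The clockwise order runs forwards along the first row and then backwards along the second, so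
exchanging the rows reverses it exactly, without a cyclic shift. -/
theorem boundary_swap_lt [LinearOrder X] [LinearOrder Y] (a b : X ⊕ Y) :
    boundary a.swap < boundary b.swap ↔ boundary b < boundary a := by
  rcases a with a | a <;> rcases b with b | b <;> simp

variable [LinearOrder X] [LinearOrder Y] {m : ℕ}

/-- The reflection of a diagram in a horizontal line. -/
def Diagram.flip (d : Diagram X Y m) : Diagram Y X m where
  top := d.bot
  bot := d.top
  rel := d.rel.comap Sum.swap
  colour := by
    intro a b h
    have := d.colour h
    rcases a with a | a <;> rcases b with b | b <;> exact this
  pairing := d.pairing.comap_equiv (Equiv.sumComm Y X)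
  planar := by
    have hc : ∀ a : Y ⊕ X, Sum.elim d.bot d.top a = Sum.elim d.top d.bot a.swap := by
      rintro (a | a) <;> rfl
    intro a b c e hab hbc hce hac hbe
    -- Since the order is reversed, planarity of `d` compares the last endpoints `e` and `c` instead
    -- of `a` and `b`; each edge has one colour, so this is the same comparison.
    rw [hc, hc, show Sum.elim d.top d.bot a.swap = Sum.elim d.top d.bot c.swap from d.colour hac,
      show Sum.elim d.top d.bot b.swap = Sum.elim d.top d.bot e.swap from d.colour hbe]
    exact (d.planar e.swap c.swap b.swap a.swap ((boundary_swap_lt _ _).2 hce)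
      ((boundary_swap_lt _ _).2 hbc) ((boundary_swap_lt _ _).2 hab) (d.rel.symm' hbe)
      (d.rel.symm' hac)).symm

theorem Diagram.flip_flip (d : Diagram X Y m) : d.flip.flip = d :=
  Diagram.ext rfl rfl (comap_swap_comap_swap d.rel)

theorem Diagram.flip_one (c : X → Fin m) : (Diagram.one c).flip = Diagram.one c := by
  refine Diagram.ext rfl rfl ?_
  ext a b
  rcases a with a | a <;> rcases b with b | b <;> rfl

end Flip

/-! ### Diagrams that lose no line. -/

section Identity

/-- Consider a smallest moved point `a`. Its preimage is not smaller, for it would be fixed; so it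
is larger, and monotonicity gives `σ a < a`. Then `σ a` is fixed, against injectivity. -/
theorem perm_eq_of_strictMono_on_fibres {A C : Type} [Finite A] [LinearOrder A] (c : A → C)
    (σ : Equiv.Perm A) (hc : ∀ a, c (σ a) = c a)
    (hσ : ∀ a b, c a = c b → a < b → σ a < σ b) (a : A) : σ a = a := by
  induction a using WellFoundedLT.induction with
  | ind a ih =>
    by_contra hne
    have hca : c (σ.symm a) = c a := by rw [← hc (σ.symm a), σ.apply_symm_apply]
    rcases lt_trichotomy (σ.symm a) a with h | h | h
    · have := ih _ h
      rw [σ.apply_symm_apply] at this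
      exact h.ne this.symm
    · exact hne ((σ.symm_apply_eq.1 h).symm)
    · have h1 := hσ _ _ hca.symm h
      rw [σ.apply_symm_apply] at h1
      exact hne (σ.injective (ih _ h1))

variable {Y : Type} [LinearOrder Y] [Finite Y] {m : ℕ}

/-- Following the lines upwards is injective, hence a permutation of the nodes. It preserves
colours, and lines of one colour do not cross, so it is increasing on each colour class and
therefore trivial. -/
theorem Diagram.eq_one_of_bot_propagating (d : Diagram Y Y m) (hd : d.top = d.bot)
    (h : ∀ y, ∃ x, d.rel (Sum.inr y) (Sum.inl x)) : d = Diagram.one d.top := by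
  choose f hf using h
  have hinj : Function.Injective f := by
    intro y y' hyy
    by_contra hne
    obtain ⟨b, -, hb⟩ := d.pairing (Sum.inr y)
    have h1 := hb (Sum.inl (f y)) ⟨by simp, hf y⟩
    have h2 := hb (Sum.inr y') ⟨fun h => hne (Sum.inr_injective h).symm,
      d.rel.trans' (hf y) (hyy ▸ d.rel.symm' (hf y'))⟩
    simp [← h2] at h1
  let σ : Equiv.Perm Y := Equiv.ofBijective f (Finite.injective_iff_bijective.1 hinj)
  have hcol : ∀ y, d.bot y = d.top (f y) := fun y => d.colour (hf y)
  have hσ : ∀ y, f y = y := by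
    refine perm_eq_of_strictMono_on_fibres d.top σ
      (fun y => by rw [hd]; exact (congrFun hd _).symm.trans (hcol y).symm) ?_
    intro a b hab hlt
    by_contra hcon
    have hne : f a ≠ f b := fun h => hlt.ne (hinj h)
    have hlt' : f b < f a := lt_of_le_of_ne (not_lt.1 hcon) hne.symm
    -- With `a < b` below and `f b < f a` above, the clockwise order is `f b, f a, b, a`, so the two
    -- lines would cross.
    refine d.planar (Sum.inl (f b)) (Sum.inl (f a)) (Sum.inr b) (Sum.inr a) (by simpa)
      (by simp) (by simpa) (d.rel.symm' (hf b)) (d.rel.symm' (hf a)) ?_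
    change d.top (f b) = d.top (f a)
    rw [← hcol, ← hcol, ← hd, hab]
  have hrel : Setoid.ker (Sum.elim id id) ≤ d.rel := by
    have h1 : ∀ y, d.rel (Sum.inr y) (Sum.inl y) := fun y => by
      have := hf y
      rwa [hσ] at this
    intro a b hab
    have hab' : (Sum.elim id id a : Y) = Sum.elim id id b := hab
    have h2 : ∀ a : Y ⊕ Y, d.rel a (Sum.inl (Sum.elim id id a)) := by
      rintro (a | a)
      · exact d.rel.refl' _
      · exact h1 a
    exact d.rel.trans' (h2 a) (hab' ▸ d.rel.symm' (h2 b))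
  -- A pairing that contains another pairing equals it, because partners are unique.
  refine Diagram.ext rfl hd.symm (le_antisymm ?_ hrel)
  intro a b hab
  by_cases h : b = a
  · exact h ▸ Setoid.refl' _ _
  · obtain ⟨e, ⟨he1, he2⟩, -⟩ := (Diagram.one d.top).pairing a
    rw [(d.pairing a).unique ⟨h, hab⟩ ⟨he1, hrel he2⟩]
    exact he2

theorem Diagram.eq_one_of_top_propagating (d : Diagram Y Y m) (hd : d.top = d.bot)
    (h : ∀ x, ∃ y, d.rel (Sum.inl x) (Sum.inr y)) : d = Diagram.one d.top := by
  have := d.flip.eq_one_of_bot_propagating hd.symm h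
  rw [← d.flip_flip, this, Diagram.flip_one]
  rfl

end Identity

/-! ### The bilinear form, its radical and the simple head. -/

section Form

variable {n m : ℕ} (δ : Fin m → ℂ) {lam : Fin m → ℕ}

/-- The colours of the cut points. -/
def cutColour (lam : Fin m → ℕ) : CutPoints lam → Fin m := fun y => (ofLex y).1

instance : Finite (CutPoints lam) := inferInstanceAs (Finite (Σ j, Fin (lam j)))

/-- A line that reaches the bottom of the product has passed through `d`; so if the product loses
none and keeps the colours, `d` has no freedom left. -/
theorem eq_one_of_linMul_half {X : Type} [LinearOrder X] [Finite X]
    (x : Diagram X (CutPoints lam) m) (hx : x.bot = cutColour lam)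
    (d : Diagram (CutPoints lam) (CutPoints lam) m) (h : x.bot = d.top)
    (hbot : (x.comp d h).bot = cutColour lam)
    (hp : ∀ y, ∃ z, (x.comp d h).rel (Sum.inr y) (Sum.inl z)) :
    d = Diagram.one (cutColour lam) := by
  have h1 : d.top = cutColour lam := h.symm.trans hx
  rw [d.eq_one_of_bot_propagating (h1.trans hbot.symm)
    (fun y => compRel_propagating x.rel d.rel y (hp y)), h1]

theorem one_propagating_bot (y : CutPoints lam) :
    ∃ x, (Diagram.one (cutColour lam)).rel (Sum.inr y) (Sum.inl x) := ⟨y, rfl⟩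

theorem one_propagating_top (y : CutPoints lam) :
    ∃ x, (Diagram.one (cutColour lam)).rel (Sum.inl y) (Sum.inr x) := ⟨y, rfl⟩

theorem compRel_propagating_top {X Y Z : Type} (r : Setoid (X ⊕ Y)) (s : Setoid (Y ⊕ Z)) (x : X)
    (h : ∃ z, compRel r s (Sum.inl x) (Sum.inr z)) : ∃ y, r (Sum.inl x) (Sum.inr y) := by
  refine compRel_propagating (s.comap Sum.swap) (r.comap Sum.swap) x ?_
  rw [← compRel_comap_swap]
  exact h

/-- When every defect of `x` is joined to a defect of `y`, the composite on the cut points loses no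
line and so is the identity diagram. This expresses the form through the product, where
associativity is available. -/
theorem gram_eq_diagramMul (x y : HalfDiagram n lam) :
    gram δ x y = diagramMul δ x.1.flip y.1 (Diagram.one (cutColour lam)) := by
  classical
  by_cases ht : x.1.top = y.1.top
  · have h : x.1.flip.bot = y.1.top := ht
    rw [diagramMul, dif_pos h, Finsupp.single_apply]
    have hiff : (x.1.top = y.1.top ∧ ∀ a : CutPoints lam, ∃ b : CutPoints lam,
        compRel (x.1.rel.comap Sum.swap) y.1.rel (Sum.inl a) (Sum.inr b)) ↔
        x.1.flip.comp y.1 h = Diagram.one (cutColour lam) := by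
      constructor
      · rintro ⟨-, hp⟩
        have h1 : (x.1.flip.comp y.1 h).top = cutColour lam := x.2.1
        have h2 : (x.1.flip.comp y.1 h).bot = cutColour lam := y.2.1
        rw [(x.1.flip.comp y.1 h).eq_one_of_top_propagating (h1.trans h2.symm) hp, h1]
      · intro he
        refine ⟨ht, fun a => ?_⟩
        have := one_propagating_top a
        rw [← he] at this
        exact this
    rw [gram]
    exact if_congr hiff rfl rfl
  · rw [gram, if_neg fun h => ht h.1, diagramMul, dif_neg (show ¬ x.1.flip.bot = y.1.top from ht)]
    rfl

/-- Reflection exchanges the two gluings and preserves closed loops. The condition on defects is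
symmetric because it forces the composite to be the identity, which equals its reflection. -/
theorem gram_comm (x y : HalfDiagram n lam) : gram δ x y = gram δ y x := by
  classical
  have key : ∀ x y : HalfDiagram n lam, x.1.top = y.1.top →
      (∀ a : CutPoints lam, ∃ b : CutPoints lam,
        compRel (x.1.rel.comap Sum.swap) y.1.rel (Sum.inl a) (Sum.inr b)) →
      gram δ x y = gram δ y x := by
    intro x y ht hp
    have h : x.1.flip.bot = y.1.top := ht
    have h1 : (x.1.flip.comp y.1 h).top = cutColour lam := x.2.1
    have h2 : (x.1.flip.comp y.1 h).bot = cutColour lam := y.2.1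
    have h3 := (x.1.flip.comp y.1 h).eq_one_of_top_propagating (h1.trans h2.symm) hp
    have h4 : compRel (y.1.rel.comap Sum.swap) x.1.rel =
        (compRel (x.1.rel.comap Sum.swap) y.1.rel).comap Sum.swap := by
      rw [compRel_comap_swap, comap_swap_comap_swap]
    have h5 : ∀ a : CutPoints lam, ∃ b : CutPoints lam,
        compRel (y.1.rel.comap Sum.swap) x.1.rel (Sum.inl a) (Sum.inr b) := by
      intro a
      rw [h4]
      refine ⟨a, ?_⟩
      change (x.1.flip.comp y.1 h).rel (Sum.inr a) (Sum.inl a)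
      rw [h3]
      exact rfl
    rw [gram, gram, if_pos ⟨ht, hp⟩, if_pos ⟨ht.symm, h5⟩]
    refine Finset.prod_congr rfl fun j _ => ?_
    rw [← loops_swap, comap_swap_comap_swap, ht]
  by_cases h : x.1.top = y.1.top ∧ ∀ a : CutPoints lam, ∃ b : CutPoints lam,
      compRel (x.1.rel.comap Sum.swap) y.1.rel (Sum.inl a) (Sum.inr b)
  · exact key x y h.1 h.2
  · by_cases h' : y.1.top = x.1.top ∧ ∀ a : CutPoints lam, ∃ b : CutPoints lam,
      compRel (y.1.rel.comap Sum.swap) x.1.rel (Sum.inl a) (Sum.inr b)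
    · exact (key y x h'.1 h'.2).symm
    · rw [gram, gram, if_neg h, if_neg h']

/-- The basis of the cell module. -/
noncomputable def cellBasis (n : ℕ) (lam : Fin m → ℕ) :
    Module.Basis (HalfDiagram n lam) ℂ (Cell n δ lam) :=
  (Finsupp.basisSingleOne : Module.Basis (HalfDiagram n lam) ℂ (HalfDiagram n lam →₀ ℂ))

/-- A half-diagram as an element of the cell module. -/
noncomputable def halfVec (x : HalfDiagram n lam) : Cell n δ lam :=
  (Finsupp.single x 1 : HalfDiagram n lam →₀ ℂ)

theorem cellBasis_apply (x : HalfDiagram n lam) : cellBasis δ n lam x = halfVec δ x :=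
  congrFun Finsupp.coe_basisSingleOne x

theorem cellForm_single_single (x y : HalfDiagram n lam) :
    cellForm n δ lam (halfVec δ x)
      (halfVec δ y) = gram δ x y := by
  unfold cellForm halfVec
  erw [Finsupp.linearCombination_single, one_smul, Finsupp.linearCombination_single, one_smul]

theorem cellForm_single (x : HalfDiagram n lam) (b : Cell n δ lam) :
    cellForm n δ lam (halfVec δ x) b =
      linMul δ (Finsupp.single x.1.flip 1) (ofHalf n lam b) (Diagram.one (cutColour lam)) := by
  let g : Cell n δ lam →ₗ[ℂ] ℂ :=
    (Finsupp.lapply (Diagram.one (cutColour lam)) ∘ₗ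
      linMul δ (Finsupp.single x.1.flip 1) ∘ₗ ofHalf n lam : (HalfDiagram n lam →₀ ℂ) →ₗ[ℂ] ℂ)
  suffices h : cellForm n δ lam (halfVec δ x) = g from congrArg (fun l => l b) h
  refine (cellBasis δ n lam).ext fun y => ?_
  rw [cellBasis_apply, cellForm_single_single, gram_eq_diagramMul]
  change _ = linMul δ (Finsupp.single x.1.flip 1) (ofHalf n lam (Finsupp.single y 1)) _
  rw [ofHalf_single, linMul_single]

theorem cellForm_comm (a b : Cell n δ lam) :
    cellForm n δ lam a b = cellForm n δ lam b a := by
  suffices h : cellForm n δ lam = (cellForm n δ lam).flip from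
    congrArg (fun l => l a b) h
  refine (cellBasis δ n lam).ext fun x => (cellBasis δ n lam).ext fun y => ?_
  rw [cellBasis_apply, cellBasis_apply]
  exact (cellForm_single_single δ x y).trans
    ((gram_comm δ x y).trans (cellForm_single_single δ y x).symm)

/-- A diagram killed by `toHalf` has wrong colours below or has lost a line, and nothing placed
above repairs this. So the truncation in the action is invisible to the coefficient of the identity.
-/
theorem linMul_ofHalf_toHalf_apply_one (e : Diagram (CutPoints lam) (Fin n) m)
    (w : Diagram (Fin n) (CutPoints lam) m →₀ ℂ) :
    linMul δ (Finsupp.single e 1) (ofHalf n lam (toHalf n lam w)) (Diagram.one (cutColour lam)) =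
      linMul δ (Finsupp.single e 1) w (Diagram.one (cutColour lam)) := by
  induction w using Finsupp.induction_linear with
  | zero => simp only [map_zero]
  | add f g hf hg => simp only [map_add, Finsupp.add_apply, hf, hg]
  | single d c =>
    rw [single_eq_smul d c]
    simp only [map_smul, Finsupp.smul_apply]
    refine congrArg (c • ·) ?_
    by_cases hd : IsHalf d
    · rw [toHalf_single_pos n lam d hd, ofHalf_single]
    · rw [toHalf_single_neg n lam d hd, map_zero, map_zero, linMul_single, diagramMul]
      split_ifs with h
      · refine (Finsupp.single_eq_of_ne fun hone => hd ⟨?_, fun y => ?_⟩).symm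
        · exact (congrArg Diagram.bot hone).symm
        · refine compRel_propagating e.rel d.rel y ?_
          have := one_propagating_bot y
          rw [hone] at this
          exact this
      · rfl

/-- If `e` is not the reflection of a half-diagram, no product with a half-diagram is the identity;
so testing against reflected half-diagrams tests against all `e`. -/
theorem linMul_single_apply_one_eq_zero (b : HalfDiagram n lam →₀ ℂ)
    (hb : ∀ x : HalfDiagram n lam,
      linMul δ (Finsupp.single x.1.flip 1) (ofHalf n lam b) (Diagram.one (cutColour lam)) = 0)
    (e : Diagram (CutPoints lam) (Fin n) m) :
    linMul δ (Finsupp.single e 1) (ofHalf n lam b) (Diagram.one (cutColour lam)) = 0 := by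
  by_cases he : IsHalf e.flip
  · have := hb ⟨e.flip, he⟩
    rwa [Diagram.flip_flip] at this
  · clear hb
    induction b using Finsupp.induction_linear with
    | zero => simp only [map_zero, Finsupp.zero_apply]
    | add f g hf hg => simp only [map_add, Finsupp.add_apply, hf, hg, add_zero]
    | single d c =>
      rw [single_eq_smul d c]
      simp only [map_smul, Finsupp.smul_apply]
      rw [ofHalf_single, linMul_single, diagramMul]
      split_ifs with h
      · rw [Finsupp.single_eq_of_ne, smul_zero]
        refine fun hone => he ⟨(congrArg Diagram.top hone).symm, fun y => ?_⟩
        refine compRel_propagating_top e.rel d.1.rel y ?_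
        have := one_propagating_top y
        rw [hone] at this
        exact this
      · exact smul_zero c

theorem linMul_apply_one_eq_zero (b : HalfDiagram n lam →₀ ℂ)
    (hb : ∀ x : HalfDiagram n lam,
      linMul δ (Finsupp.single x.1.flip 1) (ofHalf n lam b) (Diagram.one (cutColour lam)) = 0)
    (w : Diagram (CutPoints lam) (Fin n) m →₀ ℂ) :
    linMul δ w (ofHalf n lam b) (Diagram.one (cutColour lam)) = 0 := by
  induction w using Finsupp.induction_linear with
  | zero => simp only [map_zero, LinearMap.zero_apply, Finsupp.zero_apply]
  | add f g hf hg => simp only [map_add, LinearMap.add_apply, Finsupp.add_apply, hf, hg, add_zero]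
  | single d c =>
    rw [single_eq_smul d c]
    simp only [map_smul, LinearMap.smul_apply, Finsupp.smul_apply]
    rw [linMul_single_apply_one_eq_zero δ b hb, smul_zero]

/-- Placed below a half-diagram, every diagram other than the identity gives zero, produces wrong
colours or loses a line, so only one coefficient of `u` survives. -/
theorem toHalf_linMul_half (x : HalfDiagram n lam)
    (u : Diagram (CutPoints lam) (CutPoints lam) m →₀ ℂ) :
    toHalf n lam (linMul δ (Finsupp.single x.1 1) u) =
      u (Diagram.one (cutColour lam)) • Finsupp.single x 1 := by
  classical
  induction u using Finsupp.induction_linear with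
  | zero => simp only [map_zero, Finsupp.zero_apply, zero_smul]
  | add f g hf hg => simp only [map_add, Finsupp.add_apply, hf, hg, add_smul]
  | single d c =>
    rw [single_eq_smul d c]
    simp only [map_smul, Finsupp.smul_apply]
    rw [smul_assoc]
    refine congrArg (c • ·) ?_
    rw [linMul_single]
    by_cases hd : d = Diagram.one (cutColour lam)
    · rw [hd, diagramMul_one_right, if_pos (show cutColour lam = x.1.bot from x.2.1.symm),
        toHalf_single_pos n lam x.1 x.2, Finsupp.single_eq_same, one_smul]
    · rw [Finsupp.single_eq_of_ne (Ne.symm hd), zero_smul, diagramMul]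
      split_ifs with h
      · exact toHalf_single_neg n lam _ (fun hh =>
          hd (eq_one_of_linMul_half x.1 x.2.1 d h hh.1 hh.2)) _
      · exact map_zero _

/-- The radical of the inner product, as a submodule over the algebra. -/
noncomputable def radical (n : ℕ) (lam : Fin m → ℕ) :
    Submodule (BubbleAlgebra n δ) (Cell n δ lam) where
  carrier := {b | ∀ x : HalfDiagram n lam,
    cellForm n δ lam (halfVec δ x) b = 0}
  add_mem' {a b} ha hb x := by
    rw [map_add, ha x, hb x, add_zero]
  zero_mem' x := map_zero _
  smul_mem' a b hb x := by
    have h1 : ∀ x : HalfDiagram n lam, linMul δ (Finsupp.single x.1.flip 1) (ofHalf n lam b)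
        (Diagram.one (cutColour lam)) = 0 := fun x => (cellForm_single δ x b).symm.trans (hb x)
    -- By associativity, `⟨x, a b⟩` is the coefficient of the identity in (reflected `x` times `a`)
    -- times `b`. The bracket is a combination of diagrams from the cut points to the nodes, all of
    -- which `b` annihilates in this sense.
    refine (cellForm_single δ x _).trans ?_
    refine (linMul_ofHalf_toHalf_apply_one δ x.1.flip (linMul δ a (ofHalf n lam b))).trans ?_
    exact (DFunLike.congr_fun (linMul_assoc δ (Finsupp.single x.1.flip 1) a
      (ofHalf n lam b)).symm _).trans (linMul_apply_one_eq_zero δ b h1 _)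

theorem mem_radical (b : Cell n δ lam) : b ∈ radical δ n lam ↔ ∀ x : HalfDiagram n lam,
    cellForm n δ lam (halfVec δ x) b = 0 := Iff.rfl

/-- The radical was defined through the second argument and the kernel through the first; symmetry
of the form identifies them. -/
theorem radical_restrictScalars :
    (radical δ n lam).restrictScalars ℂ = LinearMap.ker (cellForm n δ lam) := by
  ext b
  rw [Submodule.restrictScalars_mem, mem_radical, LinearMap.mem_ker]
  constructor
  · intro h
    refine (cellBasis δ n lam).ext fun x => ?_
    rw [cellBasis_apply]
    exact (cellForm_comm δ b _).trans (h x)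
  · intro h x
    rw [cellForm_comm, h]
    rfl

/-- The algebra element made of a half-diagram `x` above the reflection of `z`. -/
noncomputable def rankOne (x z : HalfDiagram n lam) : BubbleAlgebra n δ :=
  linMul (X := Fin n) (Y := CutPoints lam) (Z := Fin n) δ (Finsupp.single x.1 1)
    (Finsupp.single z.1.flip 1)

/-- Associativity lets the reflection of `z` meet `b` first, which leaves an element on the cut
points. Below `x` only its coefficient at the identity counts, and that coefficient is the value of
the form. -/
theorem rankOne_smul (x z : HalfDiagram n lam) (b : Cell n δ lam) :
    rankOne δ x z • b =
      cellForm n δ lam (halfVec δ z) b •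
        halfVec δ x := by
  rw [cellForm_single]
  change toHalf n lam (linMul δ (linMul δ (Finsupp.single x.1 1) (Finsupp.single z.1.flip 1))
    (ofHalf n lam b)) = _
  rw [linMul_assoc, toHalf_linMul_half]
  rfl

/-- If `⟨z, b⟩ ≠ 0`, the elements `rankOne δ x z` carry `b` to nonzero multiples of all basis
vectors `x`. -/
theorem eq_top_of_not_le_radical (N : Submodule (BubbleAlgebra n δ) (Cell n δ lam))
    (hN : ¬ N ≤ radical δ n lam) : N = ⊤ := by
  obtain ⟨b, hb, hbr⟩ := Set.not_subset.1 hN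
  obtain ⟨z, hz⟩ := not_forall.1 fun h => hbr ((mem_radical δ b).2 h)
  have hx : ∀ x : HalfDiagram n lam, halfVec δ x ∈ N.restrictScalars ℂ := by
    intro x
    have h1 := N.smul_mem (rankOne δ x z) hb
    rw [rankOne_smul] at h1
    have h2 := (N.restrictScalars ℂ).smul_mem (cellForm n δ lam (halfVec δ z) b)⁻¹ h1
    rwa [inv_smul_smul₀ hz] at h2
  have htop : N.restrictScalars ℂ = ⊤ := by
    rw [eq_top_iff, ← (cellBasis δ n lam).span_eq, Submodule.span_le]
    rintro _ ⟨x, rfl⟩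
    rw [cellBasis_apply]
    exact hx x
  exact (Submodule.restrictScalars_eq_top_iff ℂ _ _).1 htop

variable {δ}

theorem isCoatom_radical (hform : cellForm n δ lam ≠ 0) : IsCoatom (radical δ n lam) := by
  refine ⟨fun h => hform ?_, fun N hN => eq_top_of_not_le_radical δ N (not_le_of_gt hN)⟩
  have h1 := radical_restrictScalars δ (n := n) (lam := lam)
  rw [h, Submodule.restrictScalars_top] at h1
  exact LinearMap.ker_eq_top.1 h1.symm

/-- Every proper submodule lies in the radical, which is itself proper as the form is not zero; so
it is the only maximal submodule. -/
theorem jacobson_eq_radical (hform : cellForm n δ lam ≠ 0) :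
    Module.jacobson (BubbleAlgebra n δ) (Cell n δ lam) = radical δ n lam := by
  apply le_antisymm
  · exact sInf_le (isCoatom_radical hform)
  · refine le_sInf fun N hN => ?_
    have hle : N ≤ radical δ n lam := by
      by_contra h
      exact hN.1 (eq_top_of_not_le_radical δ N h)
    exact (hN.le_iff.1 hle).elim (fun h => absurd h (isCoatom_radical hform).1) fun h => h.le

theorem isSimpleModule_head (hform : cellForm n δ lam ≠ 0) :
    IsSimpleModule (BubbleAlgebra n δ) (Head n δ lam) := by
  rw [isSimpleModule_iff_isCoatom, jacobson_eq_radical hform]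
  exact isCoatom_radical hform

/-- The head is the quotient by the radical of the inner product. -/
noncomputable def headEquiv (hform : cellForm n δ lam ≠ 0) :
    Head n δ lam ≃ₗ[ℂ] (Cell n δ lam ⧸ LinearMap.ker (cellForm n δ lam)) :=
  (Submodule.Quotient.restrictScalarsEquiv ℂ
    (Module.jacobson (BubbleAlgebra n δ) (Cell n δ lam))).symm.trans
    (Submodule.quotEquivOfEq _ _
      (by rw [jacobson_eq_radical hform, radical_restrictScalars]))

end Form

end Bubble

namespace Bubble

/-! ### Decomposing relations by colour. -/

section ColourSplit

/-- The maps `i j` identify `A j` with the set of elements of colour `j`. -/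
structure IsColourSplit {S C : Type} {A : C → Type} (col : S → C) (i : ∀ j, A j → S) : Prop where
  injective : ∀ j, Function.Injective (i j)
  colour : ∀ j a, col (i j a) = j
  surjective : ∀ s, ∃ a, i (col s) a = s

namespace IsColourSplit

variable {S C : Type} {A : C → Type} {col : S → C} {i : ∀ j, A j → S} (h : IsColourSplit col i)

include h in
theorem exists_eq {s : S} {j : C} (hs : col s = j) : ∃ a, i j a = s := by
  subst hs
  exact h.surjective s

/-- Relations on the colour classes, put together. -/
def assemble (r : ∀ j, Setoid (A j)) : Setoid S where
  r s t := ∃ j p q, r j p q ∧ i j p = s ∧ i j q = t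
  iseqv :=
    { refl := fun s => by
        obtain ⟨a, ha⟩ := h.surjective s
        exact ⟨_, a, a, (r _).refl' a, ha, ha⟩
      symm := by
        rintro s t ⟨j, p, q, h1, h2, h3⟩
        exact ⟨j, q, p, (r j).symm' h1, h3, h2⟩
      trans := by
        rintro s t w ⟨j, p, q, h1, h2, h3⟩ ⟨j', p', q', h1', h2', h3'⟩
        obtain rfl : j = j' := by rw [← h.colour j q, h3, ← h2', h.colour]
        obtain rfl : q = p' := h.injective j (h3.trans h2'.symm)
        exact ⟨j, p, q', (r j).trans' h1 h1', h2, h3'⟩ }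

theorem assemble_le (r : ∀ j, Setoid (A j)) : h.assemble r ≤ Setoid.ker col := by
  rintro s t ⟨j, p, q, -, rfl, rfl⟩
  exact (h.colour j p).trans (h.colour j q).symm

theorem comap_assemble (r : ∀ j, Setoid (A j)) (j : C) : (h.assemble r).comap (i j) = r j := by
  ext p q
  constructor
  · rintro ⟨j', p', q', h1, h2, h3⟩
    obtain rfl : j' = j := by rw [← h.colour j' p', h2, h.colour]
    rwa [← h.injective _ h2, ← h.injective _ h3]
  · exact fun hpq => ⟨j, p, q, hpq, rfl, rfl⟩

/-- Since related elements share a colour, every related pair is visible inside one colour class. -/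
theorem assemble_comap {r : Setoid S} (hr : r ≤ Setoid.ker col) :
    h.assemble (fun j => r.comap (i j)) = r := by
  ext s t
  constructor
  · rintro ⟨j, p, q, h1, rfl, rfl⟩
    exact h1
  · intro hst
    obtain ⟨p, hp⟩ := h.surjective s
    obtain ⟨q, hq⟩ := h.exists_eq (hr hst).symm
    exact ⟨col s, p, q, by change r _ _; rwa [hp, hq], hp, hq⟩

theorem isPairing_assemble {r : ∀ j, Setoid (A j)} (hr : ∀ j, IsPairing (r j)) :
    IsPairing (h.assemble r) := by
  intro s
  obtain ⟨a, ha⟩ := h.surjective s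
  obtain ⟨b, ⟨h1, h2⟩, h3⟩ := hr _ a
  refine ⟨i _ b, ⟨fun hb => h1 (h.injective _ (hb.trans ha.symm)), _, a, b, h2, ha, rfl⟩, ?_⟩
  rintro t ⟨hts, j, p, q, h4, h5, rfl⟩
  obtain rfl : j = col s := by rw [← h5, h.colour]
  obtain rfl : p = a := h.injective _ (h5.trans ha.symm)
  rw [h3 q ⟨fun hq => hts (by rw [hq, ha]), h4⟩]

include h in
theorem isPairing_comap {r : Setoid S} (hr : IsPairing r) (hcol : r ≤ Setoid.ker col) (j : C) :
    IsPairing (r.comap (i j)) := by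
  intro a
  obtain ⟨t, ⟨h1, h2⟩, h3⟩ := hr (i j a)
  obtain ⟨b, rfl⟩ := h.exists_eq ((hcol h2).symm.trans (h.colour j a))
  refine ⟨b, ⟨fun hb => h1 (by rw [hb]), h2⟩, fun c hc => h.injective j (h3 _ ⟨fun hca => ?_, hc.2⟩)⟩
  exact hc.1 (h.injective j hca)

variable {T : Type} {B : C → Type} {col' : T → C} {i' : ∀ j, B j → T} (h' : IsColourSplit col' i')

include h h' in
theorem sum : IsColourSplit (A := fun j => A j ⊕ B j) (Sum.elim col col')
    (fun j => Sum.map (i j) (i' j)) where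
  injective j := (h.injective j).sumMap (h'.injective j)
  colour j := by
    rintro (a | b)
    · exact h.colour j a
    · exact h'.colour j b
  surjective := by
    rintro (s | t)
    · obtain ⟨a, ha⟩ := h.surjective s
      exact ⟨Sum.inl a, congrArg Sum.inl ha⟩
    · obtain ⟨b, hb⟩ := h'.surjective t
      exact ⟨Sum.inr b, congrArg Sum.inr hb⟩

end IsColourSplit

end ColourSplit

/-! ### Gluing respects the decomposition by colour. -/

section GlueSplit

variable {X Y Z C : Type} {A B D : C → Type} {cX : X → C} {cY : Y → C} {cZ : Z → C}
  {e : ∀ j, A j → X} {f : ∀ j, B j → Y} {g : ∀ j, D j → Z}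
  (he : IsColourSplit cX e) (hf : IsColourSplit cY f) (hg : IsColourSplit cZ g)
  {r : Setoid (X ⊕ Y)} {s : Setoid (Y ⊕ Z)}
  (hr : r ≤ Setoid.ker (Sum.elim cX cY)) (hs : s ≤ Setoid.ker (Sum.elim cY cZ))

theorem upper_map (j : C) (a : A j ⊕ B j) :
    (Sum.map (e j) (Sum.map (f j) (g j)) (upper a) : X ⊕ (Y ⊕ Z)) =
      upper (Sum.map (e j) (f j) a) := by
  rcases a with a | a <;> rfl

theorem outer_map (j : C) (a : A j ⊕ D j) :
    (Sum.map (e j) (Sum.map (f j) (g j)) (outer a) : X ⊕ (Y ⊕ Z)) =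
      outer (Sum.map (e j) (g j) a) := by
  rcases a with a | a <;> rfl

include he hf hg hr hs

/-- Gluing within each colour and assembling the results gives an equivalence relation that already
contains `r` and `s`; by minimality the glued relation creates no further connections. -/
theorem glue_comap_map (j : C) :
    (glue r s).comap (Sum.map (e j) (Sum.map (f j) (g j))) =
      glue (r.comap (Sum.map (e j) (f j))) (s.comap (Sum.map (f j) (g j))) := by
  have hT := he.sum (hf.sum hg)
  have hle : glue r s ≤ hT.assemble fun j =>
      glue (r.comap (Sum.map (e j) (f j))) (s.comap (Sum.map (f j) (g j))) := by
    rw [glue_le_iff]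
    constructor
    · intro a b hab
      rw [← (he.sum hf).assemble_comap hr] at hab
      obtain ⟨j, p, q, h1, rfl, rfl⟩ := hab
      exact ⟨j, upper p, upper q, glue_upper _ _ h1, upper_map j p, upper_map j q⟩
    · intro a b hab
      rw [← (hf.sum hg).assemble_comap hs] at hab
      obtain ⟨j, p, q, h1, rfl, rfl⟩ := hab
      exact ⟨j, lower p, lower q, glue_lower _ _ h1, rfl, rfl⟩
  apply le_antisymm
  · rw [← hT.comap_assemble (fun j =>
      glue (r.comap (Sum.map (e j) (f j))) (s.comap (Sum.map (f j) (g j)))) j]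
    exact fun {a b} hab => hle hab
  · rw [glue_le_iff]
    constructor
    · intro a b hab
      have := glue_upper r s (show r _ _ from hab)
      rwa [← upper_map (g := g), ← upper_map (g := g)] at this
    · intro a b hab
      exact glue_lower r s (show s _ _ from hab)

theorem compRel_comap_map (j : C) :
    (compRel r s).comap (Sum.map (e j) (g j)) =
      compRel (r.comap (Sum.map (e j) (f j))) (s.comap (Sum.map (f j) (g j))) := by
  rw [compRel, compRel, ← glue_comap_map he hf hg hr hs]
  ext a b
  change glue r s (outer _) (outer _) ↔ glue r s (Sum.map _ _ (outer _)) (Sum.map _ _ (outer _))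
  rw [outer_map, outer_map]

/-- Components of the glued graph are monochromatic, so those formed by middle nodes of colour `j`
lie in the part of colour `j` and are counted there. -/
theorem loops_comap_map [Finite X] [Finite Y] [Finite Z] (j : C) :
    loops r s {y | cY y = j} =
      loops (r.comap (Sum.map (e j) (f j))) (s.comap (Sum.map (f j) (g j))) Set.univ := by
  have hT := he.sum (hf.sum hg)
  have hcol : glue r s ≤ Setoid.ker (Sum.elim cX (Sum.elim cY cZ)) := by
    rw [glue_le_iff]
    refine ⟨fun {a b} hab => ?_, fun {a b} hab => hs hab⟩
    have := hr hab
    rcases a with a | a <;> rcases b with b | b <;> exact this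
  rw [loops, loops, ← glue_comap_map he hf hg hr hs,
    blocksIn_comap (glue r s) (Sum.map (e j) (Sum.map (f j) (g j)))]
  · congr 1
    ext a
    rcases a with a | a | a <;> simp [hf.colour]
  · rintro _ ⟨y, hy, rfl⟩
    obtain ⟨b, rfl⟩ := hf.exists_eq hy
    exact ⟨Sum.inr (Sum.inl b), rfl⟩
  · intro a p ha hap _
    exact ha (hT.exists_eq ((hcol hap).trans (hT.colour j p)))

end GlueSplit

/-! ### Decomposing diagrams by colour. -/

section DiagramSplit

variable {X Y : Type} [LinearOrder X] [LinearOrder Y] {m : ℕ} {A B : Fin m → Type}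
  [∀ j, LinearOrder (A j)] [∀ j, LinearOrder (B j)] {cX : X → Fin m} {cY : Y → Fin m}
  {e : ∀ j, A j → X} {f : ∀ j, B j → Y}
  (he : IsColourSplit cX e) (hf : IsColourSplit cY f)
  (he' : ∀ j, StrictMono (e j)) (hf' : ∀ j, StrictMono (f j))

include he' hf' in
theorem boundary_map_lt (j : Fin m) (a b : A j ⊕ B j) :
    boundary (Sum.map (e j) (f j) a) < boundary (Sum.map (e j) (f j) b) ↔
      boundary a < boundary b := by
  rcases a with a | a <;> rcases b with b | b <;> simp [(he' j).lt_iff_lt, (hf' j).lt_iff_lt]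

/-- The part of colour `j` of a diagram, as a diagram in one colour. -/
def Diagram.restrict (d : Diagram X Y m) (ht : d.top = cX) (hb : d.bot = cY) (j : Fin m) :
    Diagram (A j) (B j) 1 where
  top _ := 0
  bot _ := 0
  rel := d.rel.comap (Sum.map (e j) (f j))
  colour _ _ _ := Subsingleton.elim _ _
  pairing := (he.sum hf).isPairing_comap d.pairing (by rw [← ht, ← hb]; exact d.colour) j
  planar a b c d' hab hbc hcd hac hbd := by
    refine absurd ?_ (d.planar _ _ _ _ ((boundary_map_lt he' hf' j a b).2 hab)
      ((boundary_map_lt he' hf' j b c).2 hbc) ((boundary_map_lt he' hf' j c d').2 hcd) hac hbd)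
    rw [ht, hb]
    exact ((he.sum hf).colour j a).trans ((he.sum hf).colour j b).symm

/-- A diagram put together from its parts of a single colour. -/
def Diagram.assemble (d : ∀ j, Diagram (A j) (B j) 1) : Diagram X Y m where
  top := cX
  bot := cY
  rel := (he.sum hf).assemble fun j => (d j).rel
  colour := (he.sum hf).assemble_le _
  pairing := (he.sum hf).isPairing_assemble fun j => (d j).pairing
  planar := by
    rintro _ _ _ _ hab hbc hcd ⟨j, p, q, h1, rfl, rfl⟩ ⟨j', p', q', h1', rfl, rfl⟩ hcol
    -- Edges of equal colour come from the same part, where planarity forbids the crossing; only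
    -- such crossings are excluded in the assembled diagram.
    obtain rfl : j = j' := by
      rw [← (he.sum hf).colour j p, hcol, (he.sum hf).colour]
    rw [boundary_map_lt he' hf'] at hab hbc hcd
    exact (d j).planar _ _ _ _ hab hbc hcd h1 h1' (Subsingleton.elim _ _)

end DiagramSplit

/-! ### Half-diagrams as colourings with link states, and the rank of the Gram matrix. -/

section Concrete

variable {n m v : ℕ} (δ : Fin m → ℂ) (lam : Fin m → ℕ)

/-- Colourings of `n` nodes with `lam j + 2 * u j` nodes of colour `j`. -/
abbrev Colouring (n : ℕ) (lam u : Fin m → ℕ) : Type :=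
  {c : Fin n → Fin m // ∀ j, Fintype.card {i // c i = j} = lam j + 2 * u j}

/-- Half-diagrams of the Temperley-Lieb algebra with `k` nodes and `p` arcs. -/
abbrev LinkState (k p : ℕ) : Type := HalfDiagram k (fun _ : Fin 1 => k - 2 * p)

/-- The nodes of colour `j` from left to right. -/
def nodeEmb {lam u : Fin m → ℕ} (c : Colouring n lam u) (j : Fin m) :
    Fin (lam j + 2 * u j) → Fin n :=
  (Finset.univ.filter fun i => c.1 i = j).orderEmbOfFin
    ((Fintype.card_subtype _).symm.trans (c.2 j))

theorem nodeEmb_strictMono {lam u : Fin m → ℕ} (c : Colouring n lam u) (j : Fin m) :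
    StrictMono (nodeEmb c j) := OrderEmbedding.strictMono _

theorem isColourSplit_nodeEmb {lam u : Fin m → ℕ} (c : Colouring n lam u) :
    IsColourSplit c.1 (nodeEmb c) where
  injective j := (nodeEmb_strictMono c j).injective
  colour j a := (Finset.mem_filter.1 (Finset.orderEmbOfFin_mem _
    ((Fintype.card_subtype _).symm.trans (c.2 j)) a)).2
  surjective s := by
    have h : s ∈ (Finset.univ.filter fun i => c.1 i = c.1 s) := by simp
    rw [← Finset.mem_coe, ← Finset.range_orderEmbOfFin _
      ((Fintype.card_subtype _).symm.trans (c.2 _))] at h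
    exact h

/-- The cut points of colour `j`. -/
def cutEmb (lam u : Fin m → ℕ) (j : Fin m)
    (y : CutPoints fun _ : Fin 1 => lam j + 2 * u j - 2 * u j) : CutPoints lam :=
  -- The natural-number difference counting the defects of a link state is exact here: `lam j + 2 *
  -- u j - 2 * u j = lam j`.
  toLex ⟨j, Fin.cast (Nat.add_sub_cancel _ _) (ofLex y).2⟩

theorem cutEmb_strictMono (lam u : Fin m → ℕ) (j : Fin m) : StrictMono (cutEmb lam u j) := by
  intro y y' h
  rcases Sigma.Lex.lt_def.1 h with h | ⟨h1, h2⟩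
  · exact absurd (Subsingleton.elim _ _) h.ne
  · refine Sigma.Lex.lt_def.2 (Or.inr ⟨rfl, ?_⟩)
    obtain ⟨a, b⟩ := y
    obtain ⟨a', b'⟩ := y'
    obtain rfl : a = a' := Subsingleton.elim _ _
    exact h2

theorem isColourSplit_cutEmb (lam u : Fin m → ℕ) :
    IsColourSplit (cutColour lam) (cutEmb lam u) where
  injective j := (cutEmb_strictMono lam u j).injective
  colour _ _ := rfl
  surjective s := ⟨toLex ⟨0, Fin.cast (Nat.add_sub_cancel _ _).symm (ofLex s).2⟩, rfl⟩

variable {lam}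

/-- A half-diagram put together from link states, one for each colour. -/
def assembleHalf {u : Fin m → ℕ} (c : Colouring n lam u)
    (y : ∀ j, LinkState (lam j + 2 * u j) (u j)) : HalfDiagram n lam :=
  ⟨Diagram.assemble (isColourSplit_nodeEmb c) (isColourSplit_cutEmb lam u) (nodeEmb_strictMono c)
    (cutEmb_strictMono lam u) fun j => (y j).1, rfl, fun s => by
      obtain ⟨b, hb⟩ := (isColourSplit_cutEmb lam u).surjective s
      obtain ⟨a, ha⟩ := (y _).2.2 b
      exact ⟨_, _, Sum.inr b, Sum.inl a, ha, congrArg Sum.inr hb, rfl⟩⟩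

theorem assembleHalf_comap {u : Fin m → ℕ} (c : Colouring n lam u)
    (y : ∀ j, LinkState (lam j + 2 * u j) (u j)) (j : Fin m) :
    (assembleHalf c y).1.rel.comap (Sum.map (nodeEmb c j) (cutEmb lam u j)) = (y j).1.rel :=
  ((isColourSplit_nodeEmb c).sum (isColourSplit_cutEmb lam u)).comap_assemble _ j

theorem linkState_ext {k p : ℕ} {x y : LinkState k p} (h : x.1.rel = y.1.rel) : x = y :=
  Subtype.ext (Diagram.ext (Subsingleton.elim _ _) (Subsingleton.elim _ _) h)

theorem assembleHalf_injective {u : Fin m → ℕ} (c : Colouring n lam u) :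
    Function.Injective (assembleHalf c) := by
  intro y y' h
  funext j
  apply linkState_ext
  rw [← assembleHalf_comap c y j, h, assembleHalf_comap]

/-- The colour parts of `x` are link states, because an edge from a defect ends at a node of the
same colour; and monochromatic edges make `x` recoverable from its parts. -/
theorem exists_assembleHalf {u : Fin m → ℕ} (x : HalfDiagram n lam) (c : Colouring n lam u)
    (hc : x.1.top = c.1) : ∃ y, assembleHalf c y = x := by
  have he := isColourSplit_nodeEmb c
  have hf := isColourSplit_cutEmb lam u
  have hcol : x.1.rel ≤ Setoid.ker (Sum.elim c.1 (cutColour lam)) := by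
    rw [← hc, ← show x.1.bot = cutColour lam from x.2.1]
    exact x.1.colour
  refine ⟨fun j => ⟨x.1.restrict he hf (nodeEmb_strictMono c) (cutEmb_strictMono lam u) hc x.2.1 j,
    Subsingleton.elim _ _, fun b => ?_⟩, ?_⟩
  · obtain ⟨s, hs⟩ := x.2.2 (cutEmb lam u j b)
    obtain ⟨a, rfl⟩ := he.exists_eq ((hcol hs).symm.trans (hf.colour j b))
    exact ⟨a, hs⟩
  · exact Subtype.ext (Diagram.ext hc.symm x.2.1.symm ((he.sum hf).assemble_comap hcol))

open Classical in
theorem gram_linkState {k p : ℕ} (d : ℂ) (x y : LinkState k p) :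
    gram (fun _ : Fin 1 => d) x y =
      if ∀ a : CutPoints (fun _ : Fin 1 => k - 2 * p), ∃ b,
          compRel (x.1.rel.comap Sum.swap) y.1.rel (Sum.inl a) (Sum.inr b)
      then d ^ loops (x.1.rel.comap Sum.swap) y.1.rel Set.univ else 0 := by
  have h1 : {i | x.1.top i = 0} = Set.univ := Set.eq_univ_of_forall fun i => Subsingleton.elim _ _
  unfold gram
  rw [Fin.prod_univ_one, h1]
  split_ifs with h2 h3 h3
  · rfl
  · exact absurd h2.2 h3
  · exact absurd ⟨Subsingleton.elim _ _, h3⟩ h2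
  · rfl

/-- A defect can only be joined to a defect of its own colour, so the condition on defects splits
into one condition for each colour; the loops of colour `j` are those of the `j`-th pair of link
states. -/
theorem gram_assembleHalf {u : Fin m → ℕ} (c : Colouring n lam u)
    (x y : ∀ j, LinkState (lam j + 2 * u j) (u j)) :
    gram δ (assembleHalf c x) (assembleHalf c y) =
      ∏ j, gram (fun _ : Fin 1 => δ j) (x j) (y j) := by
  classical
  have he := isColourSplit_nodeEmb c
  have hf := isColourSplit_cutEmb lam u
  set r := (assembleHalf c x).1.rel.comap Sum.swap with hr
  set s := (assembleHalf c y).1.rel with hs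
  have hs' : s ≤ Setoid.ker (Sum.elim c.1 (cutColour lam)) := (assembleHalf c y).1.colour
  have hr' : r ≤ Setoid.ker (Sum.elim (cutColour lam) c.1) := (assembleHalf c x).1.flip.colour
  have hrj : ∀ j, r.comap (Sum.map (cutEmb lam u j) (nodeEmb c j)) =
      (x j).1.rel.comap Sum.swap := by
    intro j
    rw [← assembleHalf_comap c x j]
    ext a b
    rcases a with a | a <;> rcases b with b | b <;> rfl
  have hcomp : ∀ j, (compRel r s).comap (Sum.map (cutEmb lam u j) (cutEmb lam u j)) =
      compRel ((x j).1.rel.comap Sum.swap) (y j).1.rel := by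
    intro j
    rw [compRel_comap_map hf he hf hr' hs' j, hrj, hs, assembleHalf_comap]
  have hloops : ∀ j, loops r s {i | c.1 i = j} =
      loops ((x j).1.rel.comap Sum.swap) (y j).1.rel Set.univ := by
    intro j
    rw [loops_comap_map hf he hf hr' hs' j, hrj, hs, assembleHalf_comap]
  have hcc : compRel r s ≤ Setoid.ker (Sum.elim (cutColour lam) (cutColour lam)) :=
    ((assembleHalf c x).1.flip.comp (assembleHalf c y).1 rfl).colour
  have hiff : (∀ a : CutPoints lam, ∃ b : CutPoints lam, compRel r s (Sum.inl a) (Sum.inr b)) ↔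
      ∀ j, ∀ a : CutPoints (fun _ : Fin 1 => lam j + 2 * u j - 2 * u j), ∃ b,
        compRel ((x j).1.rel.comap Sum.swap) (y j).1.rel (Sum.inl a) (Sum.inr b) := by
    constructor
    · intro h j a
      obtain ⟨b, hb⟩ := h (cutEmb lam u j a)
      obtain ⟨b', rfl⟩ := hf.exists_eq ((hcc hb).symm.trans (hf.colour j a))
      refine ⟨b', ?_⟩
      rw [← hcomp]
      exact hb
    · intro h a
      obtain ⟨a', ha⟩ := hf.surjective a
      obtain ⟨b, hb⟩ := h _ a'
      rw [← hcomp] at hb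
      rw [← ha]
      exact ⟨_, hb⟩
  simp only [gram_linkState]
  rw [gram]
  by_cases hcond : ∀ a : CutPoints lam, ∃ b : CutPoints lam,
      compRel r s (Sum.inl a) (Sum.inr b)
  · rw [if_pos ⟨rfl, hcond⟩]
    refine Finset.prod_congr rfl fun j _ => ?_
    rw [if_pos (hiff.1 hcond j), ← hloops]
    rfl
  · rw [if_neg fun h => hcond h.2]
    -- Failure of the condition on defects in a single colour makes that factor zero, and with it
    -- the product.
    obtain ⟨j, hj⟩ := not_forall.1 fun h => hcond (hiff.2 h)
    exact (Finset.prod_eq_zero (Finset.mem_univ j) (if_neg hj)).symm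

/-- Exchanging partners is an involution without fixed points, so the elements cancel in pairs when
counted modulo two. -/
theorem even_card_of_isPairing {A : Type} [Fintype A] {r : Setoid A} (hr : IsPairing r) :
    Even (Fintype.card A) := by
  obtain ⟨f, hf1, -, -, hf4⟩ := hr.partner
  have h : ∑ _a : A, (1 : ZMod 2) = 0 :=
    Finset.sum_involution (fun a _ => f a) (fun _ _ => by decide) (fun a _ _ => hf1 a)
      (fun a _ => Finset.mem_univ _) (fun a _ => hf4 a)
  rw [Finset.sum_const, Finset.card_univ, nsmul_eq_mul, mul_one] at h
  exact (ZMod.natCast_eq_zero_iff_even).1 h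

theorem isColourSplit_subtype {S C : Type} (c : S → C) :
    IsColourSplit (A := fun j => {s // c s = j}) c (fun _ s => s.1) where
  injective _ := Subtype.val_injective
  colour _ a := a.2
  surjective s := ⟨⟨s, rfl⟩, rfl⟩

theorem isColourSplit_cutPoints (lam : Fin m → ℕ) :
    IsColourSplit (A := fun j => Fin (lam j)) (cutColour lam) (fun j t => toLex ⟨j, t⟩) where
  injective _ _ _ h := eq_of_heq (Sigma.mk.inj (toLex.injective h)).2
  colour _ _ := rfl
  surjective s := ⟨(ofLex s).2, rfl⟩

/-- The number of nodes of each colour of a half-diagram exceeds the number of defects by an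
even number. -/
theorem exists_arcs (x : HalfDiagram n lam) (j : Fin m) :
    ∃ u, Fintype.card {i // x.1.top i = j} = lam j + 2 * u := by
  have hcol : x.1.rel ≤ Setoid.ker (Sum.elim x.1.top (cutColour lam)) := by
    rw [← show x.1.bot = cutColour lam from x.2.1]
    exact x.1.colour
  -- The nodes and cut points of colour `j` are paired among themselves, so their total number is
  -- even; the injection of defects into nodes below gives `lam j ≤ card`.
  have hpair := ((isColourSplit_subtype x.1.top).sum (isColourSplit_cutPoints lam)).isPairing_comap
    x.1.pairing hcol j
  have heven := even_card_of_isPairing hpair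
  rw [Fintype.card_sum, Fintype.card_fin] at heven
  have hle : lam j ≤ Fintype.card {i // x.1.top i = j} := by
    have hex : ∀ t : Fin (lam j), ∃ a : {i // x.1.top i = j},
        x.1.rel (Sum.inr (toLex ⟨j, t⟩)) (Sum.inl a.1) := fun t => by
      obtain ⟨i, hi⟩ := x.2.2 (toLex ⟨j, t⟩)
      exact ⟨⟨i, (hcol hi).symm⟩, hi⟩
    choose f hf using hex
    have hinj : Function.Injective f := by
      intro t t' h
      by_contra hne
      have h1 := x.1.rel.trans' (hf t) (h ▸ x.1.rel.symm' (hf t'))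
      have h2 := (x.1.pairing (Sum.inr (toLex ⟨j, t⟩))).unique ⟨by simp, hf t⟩
        ⟨fun h3 => hne ((isColourSplit_cutPoints lam).injective j (Sum.inr_injective h3)).symm, h1⟩
      simp at h2
    simpa using Fintype.card_le_of_injective f hinj
  obtain ⟨k, hk⟩ := heven
  -- Here `card + lam j = k + k`, and `lam j ≤ card` makes the difference exact.
  exact ⟨k - lam j, by omega⟩

/-- The index set of the blocks of the Gram matrix. -/
abbrev BlockIndex (n v : ℕ) (lam : Fin m → ℕ) : Type := Σ u : Gam v m, Colouring n lam u.1

/-- Half-diagrams decomposed according to their colours. -/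
abbrev SplitHalf (n v : ℕ) (lam : Fin m → ℕ) : Type :=
  Σ b : BlockIndex n v lam, ∀ j, LinkState (lam j + 2 * b.1.1 j) (b.1.1 j)

/-- Half-diagrams put together from the link states of their colours. -/
def ofSplit (w : SplitHalf n v lam) : HalfDiagram n lam := assembleHalf w.1.2 w.2

/-- The sizes of the colour classes determine `u`. -/
theorem blockIndex_ext {b b' : BlockIndex n v lam} (h : b.2.1 = b'.2.1) : b = b' := by
  obtain ⟨⟨u, hu⟩, c, hc⟩ := b
  obtain ⟨⟨u', hu'⟩, c', hc'⟩ := b'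
  obtain rfl : c = c' := h
  obtain rfl : u = u' := by
    funext j
    have h1 := hc j
    have h2 := hc' j
    simp only at h1 h2
    omega
  rfl

/-- The colours of the top row determine the block, and the colour parts determine the link states.
Counting all `n` nodes shows that the arc numbers `u` sum to `v`. -/
theorem ofSplit_bijective (hlam : (∑ i, lam i) + 2 * v = n) :
    Function.Bijective (ofSplit : SplitHalf n v lam → HalfDiagram n lam) := by
  constructor
  · rintro ⟨b, y⟩ ⟨b', y'⟩ h
    obtain rfl : b = b' := blockIndex_ext (congrArg (fun x => x.1.top) h)
    exact congrArg (Sigma.mk b) (assembleHalf_injective b.2 h)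
  · intro x
    choose u hu using exists_arcs x
    have hsum : ∑ j, u j = v := by
      have h1 : ∑ j, Fintype.card {i // x.1.top i = j} = n := by
        rw [← Fintype.card_sigma, Fintype.card_congr (Equiv.sigmaFiberEquiv x.1.top),
          Fintype.card_fin]
      simp only [hu, Finset.sum_add_distrib, ← Finset.mul_sum] at h1
      omega
    obtain ⟨y, hy⟩ := exists_assembleHalf x (⟨x.1.top, hu⟩ : Colouring n lam u) rfl
    exact ⟨⟨⟨⟨u, by simp [Gam, hsum]⟩, _⟩, y⟩, hy⟩

/-- Different colourings are orthogonal by definition of the form; within one colouring the form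
factors over the colours. -/
theorem gram_ofSplit (w w' : SplitHalf n v lam) [DecidableEq (BlockIndex n v lam)] :
    gram δ (ofSplit w) (ofSplit w') =
      Matrix.blockDiagonal' (fun b : BlockIndex n v lam => Matrix.piKronecker fun j =>
        Matrix.of fun x y : LinkState (lam j + 2 * b.1.1 j) (b.1.1 j) =>
          gram (fun _ : Fin 1 => δ j) x y) w w' := by
  obtain ⟨b, y⟩ := w
  obtain ⟨b', y'⟩ := w'
  by_cases h : b = b'
  · subst h
    rw [Matrix.blockDiagonal'_apply_eq]
    exact gram_assembleHalf δ b.2 y y'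
  · rw [Matrix.blockDiagonal'_apply_ne _ _ _ h, gram,
      if_neg fun hh => h (blockIndex_ext hh.1)]

instance {X Y : Type} [LinearOrder X] [LinearOrder Y] [Finite X] [Finite Y] :
    Finite (Diagram X Y m) :=
  Finite.of_injective (β := (X → Fin m) × (Y → Fin m) × (X ⊕ Y → X ⊕ Y → Prop))
    (fun d => (d.top, d.bot, d.rel)) fun d d' h => by
      simp only [Prod.mk.injEq] at h
      exact Diagram.ext h.1 h.2.1 (Setoid.ext fun a b => iff_of_eq (congrFun₂ h.2.2 a b))

noncomputable instance : Fintype (HalfDiagram n lam) := Fintype.ofFinite _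

instance : Module.Finite ℂ (Cell n δ lam) :=
  inferInstanceAs (Module.Finite ℂ (HalfDiagram n lam →₀ ℂ))

theorem finrank_cell_quotient :
    Module.finrank ℂ (Cell n δ lam ⧸ LinearMap.ker (cellForm n δ lam)) =
      (Matrix.of fun x y : HalfDiagram n lam => gram δ x y).rank :=
  finrank_quotient_ker_form (B := HalfDiagram n lam) (cellForm n δ lam) _
    (cellForm_single_single δ)

/-- Both sides are ranks of Gram matrices: that of the cell module is block diagonal with Kronecker
blocks, whose factors are the Gram matrices of the Temperley–Lieb cell modules. -/
theorem finrank_cell_quotient_eq_sum (hlam : (∑ i, lam i) + 2 * v = n) :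
    Module.finrank ℂ (Cell n δ lam ⧸ LinearMap.ker (cellForm n δ lam)) =
      ∑ u ∈ Gam v m, multi lam u *
        ∏ i, Module.finrank ℂ (TLHead (lam i + 2 * u i) (u i) (δ i)) := by
  classical
  rw [finrank_cell_quotient,
    ← Matrix.rank_submatrix _ (Equiv.ofBijective _ (ofSplit_bijective hlam))
      (Equiv.ofBijective _ (ofSplit_bijective hlam))]
  have hmat : (Matrix.of fun x y : HalfDiagram n lam => gram δ x y).submatrix
      (Equiv.ofBijective _ (ofSplit_bijective hlam))
      (Equiv.ofBijective _ (ofSplit_bijective hlam)) =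
      Matrix.blockDiagonal' (fun b : BlockIndex n v lam => Matrix.piKronecker fun j =>
        Matrix.of fun x y : LinkState (lam j + 2 * b.1.1 j) (b.1.1 j) =>
          gram (fun _ : Fin 1 => δ j) x y) := by
    ext w w'
    exact gram_ofSplit δ w w'
  rw [hmat, Matrix.rank_blockDiagonal', Fintype.sum_sigma, ← Finset.sum_coe_sort (Gam v m)]
  refine Finset.sum_congr rfl fun u _ => ?_
  have hcard : Fintype.card (Colouring n lam u.1) = multi lam u.1 := by
    have hu : ∑ i, u.1 i = v := by
      have := u.2
      simpa [Gam] using this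
    have hsum : ∑ i, (lam i + 2 * u.1 i) = n := by
      rw [Finset.sum_add_distrib, ← Finset.mul_sum, hu, hlam]
    rw [← Nat.card_eq_fintype_card]
    exact card_colourings n _ hsum
  -- The rank of a block depends on the colouring only through `u`, so the multinomial coefficient
  -- is spread out as a constant sum over colourings.
  rw [← hcard, ← smul_eq_mul, ← Finset.card_univ, ← Finset.sum_const]
  refine Finset.sum_congr rfl fun c _ => ?_
  rw [Matrix.rank_piKronecker]
  exact Finset.prod_congr rfl fun i _ => (finrank_cell_quotient _).symm

end Concrete

end Bubble

/-! ### The theorem. -/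

theorem mainTheorem4 (n m v : ℕ) (hn : 0 < n) (hm : 0 < m) (δ : Fin m → ℂ) (lam : Fin m → ℕ)
    (hlam : (∑ i, lam i) + 2 * v = n) (hform : Bubble.cellForm n δ lam ≠ 0) :
    IsSimpleModule (Bubble.BubbleAlgebra n δ) (Bubble.Head n δ lam) ∧
    Module.finrank ℂ (Bubble.Head n δ lam) =
      ∑ u ∈ Bubble.Gam v m, Bubble.multi lam u *
        ∏ i, Module.finrank ℂ (Bubble.TLHead (lam i + 2 * u i) (u i) (δ i)) ∧
    Nonempty (Bubble.Head n δ lam ≃ₗ[ℂ]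
      DirectSum (Bubble.Gam v m) fun u => DirectSum (Fin (Bubble.multi lam u.1)) fun _ =>
        PiTensorProduct ℂ fun i => Bubble.TLHead (lam i + 2 * u.1 i) (u.1 i) (δ i)) := by
  have hdim := (Bubble.headEquiv hform).finrank_eq.trans
    (Bubble.finrank_cell_quotient_eq_sum δ hlam)
  have : Module.Finite ℂ (Bubble.Head n δ lam) :=
    Module.Finite.equiv (Bubble.headEquiv hform).symm
  refine ⟨Bubble.isSimpleModule_head hform, hdim,
    FiniteDimensional.nonempty_linearEquiv_of_finrank_eq ?_⟩
  -- It remains to compare dimensions: finite-dimensional spaces of equal dimension are isomorphic,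
  -- and the direct sum has the dimension given by the formula.
  rw [hdim, Module.finrank_directSum, ← Finset.sum_coe_sort (Bubble.Gam v m)]
  refine Finset.sum_congr rfl fun u _ => ?_
  rw [Module.finrank_directSum, Finset.sum_const, Finset.card_univ, Fintype.card_fin, smul_eq_mul,
    finrank_piTensorProduct]
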